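/- \textbf{Lemma (Quantum vs. super-quantum capacities of Channel II).} For $0\le\epsilon\le 1$, Channel II is the following channel with two senders and two receivers. Sender $i$ inputs two bits $X_i=(r_i,a_i)\in\{0,1\}^2$, and receiver $i$ gets $Y_i\in\{0,1,e\}$. If $a_1\oplus a_2=r_1r_2$, the output is $(Y_1,Y_2)=(r_1,r_2)$ with probability $\epsilon$ and $(e,e)$ with probability $1-\epsilon$; otherwise the output is always $(e,e)$. Successive uses are independent. A code of block length $n$ at rates $R_1,R_2\ge 0$ has message sets of sizes $2^{\lceil nR_1\rceil}$ and $2^{\lceil nR_2\rceil}$, two encoders that map the message of sender $i$ to $n$ input letters, and two decoders, the $i$-th of which estimates message $i$ from the $n$ letters received by receiver $i$. The senders do not communicate. They may share a resource, so that the pair of codewords is random, with a distribution that depends on the two messages: in an \emph{entanglement-assisted} code they share a bipartite quantum state of arbitrary finite dimensions $d_1\times d_2$, and each obtains her codeword by a POVM on her own half, chosen according to her own message; in a \emph{super-quantum-assisted} code they share finitely many PR boxes, i.e. independent single-use devices with outputs $a,b\in\{0,1\}$ distributed by $P(a,b\mid x,y)=\tfrac12$ if $a\oplus b=xy$ and $0$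 otherwise, on the inputs $x,y\in\{0,1\}$ of the two senders, and each obtains her codeword from her own message by using her ends of the boxes, possibly adaptively. A pair $(R_1,R_2)$ is achievable if there is a sequence of such codes, one for each $n$, for which the probability, under independent uniform messages, that the two messages are not both decoded correctly tends to $0$. Let $C^{(\epsilon)}_{\mathrm{quantum}}$ and $C^{(\epsilon)}_{\mathrm{super\text{-}quantum}}$ be the suprema of $R_1+R_2$ over the pairs that are achievable with entanglement-assisted and with super-quantum-assisted codes, respectively. Then there is $\epsilon_0\in(0,1]$ such that for all $0<\epsilon<\epsilon_0$ $$C^{(\epsilon)}_{\mathrm{quantum}}<C^{(\epsilon)}_{\mathrm{super\text{-}quantum}}=2\epsilon .$$ -/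

import Mathlib

open scoped Kronecker ComplexOrder

noncomputable section

/-- An input letter of one sender: the bit pair `(first bit, second bit)`. -/
abbrev InLetter : Type := Bool × Bool

/-- An output letter of one receiver: a bit, or `none` for an erased bit. -/
abbrev OutLetter : Type := Option Bool

/-- A two-sender, two-receiver channel: `W x₁ x₂ y₁ y₂` is the probability of the output pair
`(y₁, y₂)` when the input pair is `(x₁, x₂)`. -/
abbrev InterferenceChannel : Type := InLetter → InLetter → OutLetter → OutLetter → ℝ

/-- The input pairs that Channel II does not erase with certainty: the exclusive or of the two
second bits is the product of the two first bits. -/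
def IsLive (x₁ x₂ : InLetter) : Prop := xor x₁.2 x₂.2 = (x₁.1 && x₂.1)

instance (x₁ x₂ : InLetter) : Decidable (IsLive x₁ x₂) := by unfold IsLive; infer_instance

/-- Channel II with parameter `ε`. Its table (rows: sender 1, columns: sender 2) is

|        |  00   |  01   |  10   |  11   |
|  00    | 00/ee |  ee   | 01/ee |  ee   |
|  01    |  ee   | 00/ee |  ee   | 01/ee |
|  10    | 10/ee |  ee   |  ee   | 11/ee |
|  11    |  ee   | 10/ee | 11/ee |  ee   |

A cell `ee` is always erased; a cell `ab/ee` yields `ab` with probability `ε` and is erased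
with probability `1 - ε`. The outputs `ab` are the first bits of the two inputs. -/
def channelII (ε : ℝ) : InterferenceChannel := fun x₁ x₂ y₁ y₂ =>
  if IsLive x₁ x₂ then
    if y₁ = some x₁.1 ∧ y₂ = some x₂.1 then ε
    else if y₁ = none ∧ y₂ = none then 1 - ε
    else 0
  else if y₁ = none ∧ y₂ = none then 1 else 0

/-- The two encoders taken together, for `K₁` and `K₂` messages and block length `n`:
`enc m₁ m₂ u v` is the probability that sender 1 transmits the codeword `u` and sender 2 the
codeword `v` when their messages are `m₁` and `m₂`. -/
abbrev Encoding (K₁ K₂ n : ℕ) : Type :=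
  Fin K₁ → Fin K₂ → (Fin n → InLetter) → (Fin n → InLetter) → ℝ

/-- A class of encodings that the senders may use. -/
abbrev EncodingClass : Type := ∀ K₁ K₂ n : ℕ, Encoding K₁ K₂ n → Prop

/-- A POVM on `ℂ^d` with outcomes in the finite set `α`. -/
def IsPOVM {d : ℕ} {α : Type} [Fintype α] (E : α → Matrix (Fin d) (Fin d) ℂ) : Prop :=
  (∀ x, (E x).PosSemidef) ∧ ∑ x, E x = 1

/-- Entanglement-assisted encodings. The senders share a (possibly mixed) state `ρ` of
`ℂ^d₁ ⊗ ℂ^d₂`, for some finite dimensions; each measures her half with a POVM that depends on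
her own message only, and transmits the outcome, a codeword. (Post-processing of the outcome
into a codeword is part of the POVM.) -/
def entanglementAssisted : EncodingClass := fun K₁ K₂ n enc =>
  ∃ (d₁ d₂ : ℕ) (ρ : Matrix (Fin d₁ × Fin d₂) (Fin d₁ × Fin d₂) ℂ)
    (A : Fin K₁ → (Fin n → InLetter) → Matrix (Fin d₁) (Fin d₁) ℂ)
    (B : Fin K₂ → (Fin n → InLetter) → Matrix (Fin d₂) (Fin d₂) ℂ),
    ρ.PosSemidef ∧ ρ.trace = 1 ∧ (∀ m, IsPOVM (A m)) ∧ (∀ m, IsPOVM (B m)) ∧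
    ∀ m₁ m₂ u v, enc m₁ m₂ u v = (ρ * (A m₁ u ⊗ₖ B m₂ v)).trace.re

/-- The PR box: the probability of the outputs `a`, `b` on the inputs `x`, `y`. -/
def prBox (a b x y : Bool) : ℝ := if xor a b = (x && y) then 1 / 2 else 0

/-- What one party may do with her ends of `k` boxes: either stop with a result, or put an input
bit into the end of some box, read the output bit there, and continue depending on it. -/
inductive BoxProtocol (k : ℕ) (α : Type) : Type where
  | finish (x : α) : BoxProtocol k α
  | query (j : Fin k) (r : Bool) (next : Bool → BoxProtocol k α) : BoxProtocol k α

/-- The result of a protocol when the outputs at the party's ends of the boxes are `a`. -/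
def BoxProtocol.result {k : ℕ} {α : Type} : BoxProtocol k α → (Fin k → Bool) → α
  | .finish x, _ => x
  | .query j _ next, a => (next (a j)).result a

/-- The input that box `i` receives at the party's end when the outputs there are `a`. A box
works once, so only the first input counts (a later query repeats the output); a box that is
never queried receives the input `false`, which is immaterial since the boxes do not signal. -/
def BoxProtocol.input {k : ℕ} {α : Type} : BoxProtocol k α → (Fin k → Bool) → Fin k → Bool
  | .finish _, _, _ => false
  | .query j r next, a, i => if i = j then r else (next (a j)).input a i

/-- Super-quantum-assisted encodings: the senders share finitely many PR boxes, and each obtains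
her codeword from a protocol that uses her ends of the boxes and depends on her own message
only. -/
def prBoxAssisted : EncodingClass := fun K₁ K₂ n enc =>
  ∃ (k : ℕ) (P : Fin K₁ → BoxProtocol k (Fin n → InLetter))
    (Q : Fin K₂ → BoxProtocol k (Fin n → InLetter)),
    ∀ m₁ m₂ u v, enc m₁ m₂ u v =
      ∑ a : Fin k → Bool, ∑ b : Fin k → Bool,
        if (P m₁).result a = u ∧ (Q m₂).result b = v then
          ∏ j, prBox (a j) (b j) ((P m₁).input a j) ((Q m₂).input b j)
        else 0

/-- The probability that the receivers do not both recover the message of their own sender, for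
independent uniform messages and `n` independent uses of the channel `W`. Receiver `i` applies
`gᵢ` to what she received; the value `none` is the error message. -/
def errorProb (W : InterferenceChannel) {K₁ K₂ n : ℕ} (enc : Encoding K₁ K₂ n)
    (g₁ : (Fin n → OutLetter) → Option (Fin K₁)) (g₂ : (Fin n → OutLetter) → Option (Fin K₂)) : ℝ :=
  ((K₁ : ℝ) * (K₂ : ℝ))⁻¹ * ∑ m₁ : Fin K₁, ∑ m₂ : Fin K₂,
    ∑ u : Fin n → InLetter, ∑ v : Fin n → InLetter,
    ∑ y₁ : Fin n → OutLetter, ∑ y₂ : Fin n → OutLetter,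
      if g₁ y₁ = some m₁ ∧ g₂ y₂ = some m₂ then 0
      else enc m₁ m₂ u v * ∏ i, W (u i) (v i) (y₁ i) (y₂ i)

/-- The number of messages `2 ^ ⌈n R⌉` at rate `R` (in bits per use) and block length `n`. -/
def messageCount (n : ℕ) (R : ℝ) : ℕ := 2 ^ ⌈(n : ℝ) * R⌉₊

/-- The rate pair `(R₁, R₂)` is achievable on `W` with encodings of the class `𝓒`. -/
def Achievable (𝓒 : EncodingClass) (W : InterferenceChannel) (R₁ R₂ : ℝ) : Prop :=
  0 ≤ R₁ ∧ 0 ≤ R₂ ∧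
  ∃ (enc : ∀ n : ℕ, Encoding (messageCount n R₁) (messageCount n R₂) n)
    (g₁ : ∀ n : ℕ, (Fin n → OutLetter) → Option (Fin (messageCount n R₁)))
    (g₂ : ∀ n : ℕ, (Fin n → OutLetter) → Option (Fin (messageCount n R₂))),
    (∀ n, 𝓒 _ _ n (enc n)) ∧
    Filter.Tendsto (fun n => errorProb W (enc n) (g₁ n) (g₂ n)) Filter.atTop (nhds 0)

/-- The sum capacity of `W` with encodings of the class `𝓒`: the supremum of `R₁ + R₂` over the
achievable rate pairs, an extended real number. -/
def sumCapacity (𝓒 : EncodingClass) (W : InterferenceChannel) : EReal :=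
  sSup {s : EReal | ∃ R₁ R₂ : ℝ, Achievable 𝓒 W R₁ R₂ ∧ s = ((R₁ + R₂ : ℝ) : EReal)}

end

open scoped Matrix

noncomputable section

/-! Call a position live if the codewords satisfy a₁ ⊕ a₂ = r₁r₂ there. Given the codewords, the set
L of unerased positions is a random subset of the live ones, each kept with probability ε, and the
receivers see the first bits on L. One PR box per channel use makes every position live, so each
receiver faces a binary erasure channel; random coding then achieves every rate below ε for both
senders, hence sum rates up to 2ε.

For the converse, fix L. The decoders turn the visible strings s, t into messages. Hence the total
probability, over all message pairs, of being live on L and decoded correctly is at most a sum over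
4^|L| pairs (s, t): the probability that the senders of the decoded messages emit s and t on L and
are live there. Each term is at most 1 (`decodedMass_le_four_pow`). But being live on L means
winning |L| CHSH games with questions s, t, so Tsirelson's bound for entangled senders reduces the
sum to (2+√2)^|L| (`entanglementAssisted.decodedMass_le`).

`one_sub_errorProb_le` turns such bounds into bounds on the success probability. The survivor count
concentrates near ε times the number k of live positions, so the weight ε^l (1-ε)^(k-l) can be
bounded by a function of l alone. Summing over L gives the exponents 2ε log 2 in general and ε
e^(-(1-ε)) (2+√2) with entanglement. For small ε the latter is near 1.256 ε, below 2ε log 2 ≈ 1.386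
ε. -/

/-! ### Channel II as random erasure of the live positions -/

/-- The positions at which a pair of codewords is not erased with certainty. -/
def livePositions {n : ℕ} (u v : Fin n → InLetter) : Finset (Fin n) :=
  Finset.univ.filter fun i => IsLive (u i) (v i)

/-- The word received when `s` is sent and exactly the positions in `L` survive. -/
def survivors {n : ℕ} (s : Fin n → Bool) (L : Finset (Fin n)) : Fin n → OutLetter :=
  fun i => if i ∈ L then some (s i) else none

/-- The first bits of a codeword. -/
def firstBits {n : ℕ} (u : Fin n → InLetter) : Fin n → Bool := fun i => (u i).1

lemma survivors_congr {n : ℕ} {s t : Fin n → Bool} {L : Finset (Fin n)}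
    (h : ∀ i ∈ L, s i = t i) : survivors s L = survivors t L := by
  funext i
  by_cases hi : i ∈ L <;> simp [survivors, hi, h]

/-- Survival and erasure exclude each other, so the transition probability is a sum of two terms,
and the product over the block expands over subsets of positions. -/
lemma channelII_eq (ε : ℝ) (x₁ x₂ : InLetter) (y₁ y₂ : OutLetter) :
    channelII ε x₁ x₂ y₁ y₂ =
      (if IsLive x₁ x₂ then ε else 0) * (if y₁ = some x₁.1 ∧ y₂ = some x₂.1 then 1 else 0) +
      (if IsLive x₁ x₂ then 1 - ε else 1) * (if y₁ = none ∧ y₂ = none then 1 else 0) := by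
  unfold channelII
  by_cases h : IsLive x₁ x₂ <;> by_cases h1 : y₁ = some x₁.1 ∧ y₂ = some x₂.1
  · simp [h, h1]
  · simp [h, h1]
  · simp [h, h1]
  · simp [h, h1]

lemma prod_channelII {n : ℕ} (ε : ℝ) (u v : Fin n → InLetter) (y₁ y₂ : Fin n → OutLetter) :
    ∏ i, channelII ε (u i) (v i) (y₁ i) (y₂ i) =
      ∑ L ∈ (livePositions u v).powerset,
        ε ^ L.card * (1 - ε) ^ ((livePositions u v).card - L.card) *
          (if y₁ = survivors (firstBits u) L ∧ y₂ = survivors (firstBits v) L then 1 else 0) := by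
  simp_rw [channelII_eq]
  rw [Finset.prod_add, Finset.powerset_univ]
  symm
  apply Finset.sum_subset_zero_on_sdiff (Finset.subset_univ _)
  · intro L hL
    simp only [Finset.mem_sdiff, Finset.mem_univ, true_and, Finset.mem_powerset,
      Finset.not_subset] at hL
    obtain ⟨i, hi, hl⟩ := hL
    have : ¬ IsLive (u i) (v i) := by simpa [livePositions] using hl
    rw [Finset.prod_eq_zero hi (by simp [this]), zero_mul]
  · intro L hL
    have hL' := Finset.mem_powerset.1 hL
    simp_rw [Finset.prod_mul_distrib]
    have e1 : ∏ i ∈ L, (if IsLive (u i) (v i) then ε else 0) = ε ^ L.card := by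
      rw [← Finset.prod_const]
      refine Finset.prod_congr rfl fun i hi => ?_
      have := hL' hi
      simp only [livePositions, Finset.mem_filter, Finset.mem_univ, true_and] at this
      simp [this]
    have e2 : ∏ i ∈ Finset.univ \ L, (if IsLive (u i) (v i) then 1 - ε else 1) =
        (1 - ε) ^ ((livePositions u v).card - L.card) := by
      rw [← Finset.card_sdiff_of_subset hL', ← Finset.prod_const, ← Finset.prod_filter]
      refine Finset.prod_congr ?_ fun _ _ => rfl
      ext i; simp [livePositions, and_comm]
    have e3 : (∏ i ∈ L, (if y₁ i = some (u i).1 ∧ y₂ i = some (v i).1 then (1 : ℝ) else 0)) *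
        ∏ i ∈ Finset.univ \ L, (if y₁ i = none ∧ y₂ i = none then (1 : ℝ) else 0) =
        if y₁ = survivors (firstBits u) L ∧ y₂ = survivors (firstBits v) L then 1 else 0 := by
      rw [Finset.prod_ite_zero, Finset.prod_ite_zero]
      simp only [Finset.prod_const_one, ← ite_and, mul_ite, mul_one, mul_zero]
      refine if_congr ?_ rfl rfl
      simp only [funext_iff, survivors, firstBits, Finset.mem_sdiff, Finset.mem_univ, true_and]
      constructor
      · rintro ⟨h1, h2⟩
        constructor <;> intro i <;> by_cases hi : i ∈ L
        all_goals simp [hi, h1, h2]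
      · rintro ⟨h1, h2⟩
        constructor <;> intro i hi <;> simp [h1 i, h2 i, hi]
    rw [← e1, ← e2, ← e3]; ring

lemma sum_prod_channelII {n : ℕ} (ε : ℝ) (u v : Fin n → InLetter)
    (F : (Fin n → OutLetter) → (Fin n → OutLetter) → ℝ) :
    ∑ y₁, ∑ y₂, F y₁ y₂ * ∏ i, channelII ε (u i) (v i) (y₁ i) (y₂ i) =
      ∑ L ∈ (livePositions u v).powerset,
        ε ^ L.card * (1 - ε) ^ ((livePositions u v).card - L.card) *
          F (survivors (firstBits u) L) (survivors (firstBits v) L) := by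
  simp_rw [prod_channelII, Finset.mul_sum]
  rw [Finset.sum_congr rfl fun y₁ _ => Finset.sum_comm, Finset.sum_comm]
  refine Finset.sum_congr rfl fun L _ => ?_
  simp [ite_and, mul_comm]

/-! ### Concentration of the number of survivors -/

lemma sum_powerset_variance {ι : Type*} (s : Finset ι) (x : ℝ) :
    ∑ L ∈ s.powerset, ((L.card : ℝ) - x * s.card) ^ 2 *
      (x ^ L.card * (1 - x) ^ (s.card - L.card)) = s.card * x * (1 - x) := by
  rw [Finset.sum_powerset_apply_card
    (fun k => ((k : ℝ) - x * s.card) ^ 2 * (x ^ k * (1 - x) ^ (s.card - k)))]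
  have h := congrArg (Polynomial.eval x) (bernsteinPolynomial.variance ℝ s.card)
  rw [Polynomial.eval_finsetSum] at h
  simp only [bernsteinPolynomial, Polynomial.eval_mul, Polynomial.eval_pow, Polynomial.eval_sub,
    Polynomial.eval_X, Polynomial.eval_natCast, Polynomial.eval_one,
    nsmul_eq_mul] at h
  rw [← h]
  refine Finset.sum_congr rfl fun k _ => ?_
  rw [nsmul_eq_mul]; ring

/-- Chebyshev's inequality for the number of survivors. -/
lemma sum_powerset_tail_le {ι : Type*} (s : Finset ι) {x c : ℝ} (h0 : 0 ≤ x) (h1 : x ≤ 1)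
    (hc : 0 < c) :
    ∑ L ∈ s.powerset with c ≤ |(L.card : ℝ) - x * s.card|,
      x ^ L.card * (1 - x) ^ (s.card - L.card) ≤ s.card / c ^ 2 := by
  have h1' : 0 ≤ 1 - x := by linarith
  rw [le_div_iff₀ (by positivity), Finset.sum_mul]
  calc _ ≤ ∑ L ∈ s.powerset with c ≤ |(L.card : ℝ) - x * s.card|,
        ((L.card : ℝ) - x * s.card) ^ 2 * (x ^ L.card * (1 - x) ^ (s.card - L.card)) := by
        refine Finset.sum_le_sum fun L hL => ?_
        rw [mul_comm]
        have h2 := (Finset.mem_filter.1 hL).2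
        have : c ^ 2 ≤ ((L.card : ℝ) - x * s.card) ^ 2 := by
          rw [← sq_abs ((L.card : ℝ) - x * s.card)]; gcongr
        gcongr
    _ ≤ ∑ L ∈ s.powerset, ((L.card : ℝ) - x * s.card) ^ 2 *
          (x ^ L.card * (1 - x) ^ (s.card - L.card)) :=
        Finset.sum_le_sum_of_subset_of_nonneg (Finset.filter_subset _ _)
          fun _ _ _ => by positivity
    _ ≤ s.card := by
        rw [sum_powerset_variance, mul_assoc]
        exact mul_le_of_le_one_right (by positivity) (by nlinarith)

lemma sum_powerset_weight {ι : Type*} (s : Finset ι) (x : ℝ) :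
    ∑ L ∈ s.powerset, x ^ L.card * (1 - x) ^ (s.card - L.card) = 1 := by
  rw [Finset.sum_pow_mul_eq_add_pow]; simp

/-! ### Converse: success probability and decoded mass -/

/-- The encoding is a probability distribution for each pair of messages. -/
def IsStochastic {K₁ K₂ n : ℕ} (enc : Encoding K₁ K₂ n) : Prop :=
  (∀ m₁ m₂ u v, 0 ≤ enc m₁ m₂ u v) ∧ ∀ m₁ m₂, ∑ u, ∑ v, enc m₁ m₂ u v = 1

lemma errorProb_eq {K₁ K₂ n : ℕ} (ε : ℝ) (enc : Encoding K₁ K₂ n)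
    (g₁ : (Fin n → OutLetter) → Option (Fin K₁)) (g₂ : (Fin n → OutLetter) → Option (Fin K₂)) :
    errorProb (channelII ε) enc g₁ g₂ =
      ((K₁ : ℝ) * (K₂ : ℝ))⁻¹ * ∑ m₁, ∑ m₂, ∑ u, ∑ v, enc m₁ m₂ u v *
        ∑ L ∈ (livePositions u v).powerset,
          ε ^ L.card * (1 - ε) ^ ((livePositions u v).card - L.card) *
          (if g₁ (survivors (firstBits u) L) = some m₁ ∧
            g₂ (survivors (firstBits v) L) = some m₂ then 0 else 1) := by
  unfold errorProb
  congr 1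
  refine Finset.sum_congr rfl fun m₁ _ => Finset.sum_congr rfl fun m₂ _ =>
    Finset.sum_congr rfl fun u _ => Finset.sum_congr rfl fun v _ => ?_
  rw [← sum_prod_channelII ε u v
    (fun y₁ y₂ => if g₁ y₁ = some m₁ ∧ g₂ y₂ = some m₂ then 0 else 1), Finset.mul_sum]
  refine Finset.sum_congr rfl fun y₁ _ => ?_
  rw [Finset.mul_sum]
  refine Finset.sum_congr rfl fun y₂ _ => ?_
  split_ifs <;> simp

/-- The total weight, over all message pairs, of the codeword pairs that are live on `L` and
whose survivors on `L` are decoded to the message pair. -/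
def decodedMass {K₁ K₂ n : ℕ} (enc : Encoding K₁ K₂ n)
    (g₁ : (Fin n → OutLetter) → Option (Fin K₁)) (g₂ : (Fin n → OutLetter) → Option (Fin K₂))
    (L : Finset (Fin n)) : ℝ :=
  ∑ m₁, ∑ m₂, ∑ u, ∑ v,
    if L ⊆ livePositions u v ∧ g₁ (survivors (firstBits u) L) = some m₁ ∧
      g₂ (survivors (firstBits v) L) = some m₂ then enc m₁ m₂ u v else 0

/-- A converse bound: success needs an atypical number of survivors, or is paid for by the
decoded mass at the survivor sets. -/
lemma one_sub_errorProb_le {K₁ K₂ n : ℕ} (hK₁ : 0 < K₁) (hK₂ : 0 < K₂) {ε c : ℝ} (h0 : 0 ≤ ε)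
    (h1 : ε ≤ 1) (hc : 0 < c) {enc : Encoding K₁ K₂ n} (henc : IsStochastic enc)
    (g₁ : (Fin n → OutLetter) → Option (Fin K₁)) (g₂ : (Fin n → OutLetter) → Option (Fin K₂))
    (D : ℕ → ℝ) (hD0 : ∀ l, 0 ≤ D l)
    (hD : ∀ l k : ℕ, l ≤ k → k ≤ n → (l : ℝ) ≤ ε * k + c → ε ^ l * (1 - ε) ^ (k - l) ≤ D l) :
    1 - errorProb (channelII ε) enc g₁ g₂ ≤
      n / c ^ 2 + ((K₁ : ℝ) * (K₂ : ℝ))⁻¹ * ∑ L : Finset (Fin n), D L.card *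
        decodedMass enc g₁ g₂ L := by
  have hK : (0 : ℝ) < (K₁ : ℝ) * K₂ := by positivity
  have h1' : 0 ≤ 1 - ε := by linarith
  have key : ∀ (m₁ : Fin K₁) (m₂ : Fin K₂) (u v : Fin n → InLetter),
      1 - n / c ^ 2 - ∑ L : Finset (Fin n), D L.card *
        (if L ⊆ livePositions u v ∧ g₁ (survivors (firstBits u) L) = some m₁ ∧
          g₂ (survivors (firstBits v) L) = some m₂ then 1 else 0) ≤
      ∑ L ∈ (livePositions u v).powerset,
          ε ^ L.card * (1 - ε) ^ ((livePositions u v).card - L.card) *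
          (if g₁ (survivors (firstBits u) L) = some m₁ ∧
            g₂ (survivors (firstBits v) L) = some m₂ then 0 else 1) := by
    intro m₁ m₂ u v
    set Λ := livePositions u v with hΛ
    have hΛn : Λ.card ≤ n := by simpa using Finset.card_le_univ Λ
    have t := sum_powerset_tail_le Λ h0 h1 hc
    have t' : (Λ.card : ℝ) / c ^ 2 ≤ n / c ^ 2 := by gcongr
    rw [Finset.sum_filter] at t
    have e : ∑ L : Finset (Fin n), D L.card *
        (if L ⊆ Λ ∧ g₁ (survivors (firstBits u) L) = some m₁ ∧
          g₂ (survivors (firstBits v) L) = some m₂ then 1 else 0) =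
        ∑ L ∈ Λ.powerset, D L.card * (if g₁ (survivors (firstBits u) L) = some m₁ ∧
          g₂ (survivors (firstBits v) L) = some m₂ then 1 else 0) := by
      have : Λ.powerset = Finset.univ.filter (fun L => L ⊆ Λ) := by ext; simp
      rw [this, Finset.sum_filter]
      refine Finset.sum_congr rfl fun L _ => ?_
      by_cases hL : L ⊆ Λ <;> simp [hL]
    rw [e]
    have w := sum_powerset_weight Λ ε
    -- The total weight is 1, and each L is paid for by one of three terms: its size is atypical, or
    -- it is decoded and `D` dominates its weight, or decoding fails.
    suffices h : ∑ L ∈ Λ.powerset, ε ^ L.card * (1 - ε) ^ (Λ.card - L.card) ≤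
        (∑ L ∈ Λ.powerset, if c ≤ |(L.card : ℝ) - ε * Λ.card| then
          ε ^ L.card * (1 - ε) ^ (Λ.card - L.card) else 0) +
        (∑ L ∈ Λ.powerset, D L.card * (if g₁ (survivors (firstBits u) L) = some m₁ ∧
          g₂ (survivors (firstBits v) L) = some m₂ then 1 else 0)) +
        ∑ L ∈ Λ.powerset,
          ε ^ L.card * (1 - ε) ^ (Λ.card - L.card) *
          (if g₁ (survivors (firstBits u) L) = some m₁ ∧
            g₂ (survivors (firstBits v) L) = some m₂ then 0 else 1) by linarith
    rw [← Finset.sum_add_distrib, ← Finset.sum_add_distrib]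
    refine Finset.sum_le_sum fun L hL => ?_
    have hcard := Finset.card_le_card (Finset.mem_powerset.1 hL)
    have hw : 0 ≤ ε ^ L.card * (1 - ε) ^ (Λ.card - L.card) := by positivity
    have := hD0 L.card
    by_cases hdec : g₁ (survivors (firstBits u) L) = some m₁ ∧
            g₂ (survivors (firstBits v) L) = some m₂
    · by_cases ht : c ≤ |(L.card : ℝ) - ε * Λ.card|
      · simp only [hdec, ht]; simp [this]
      · have hb := hD L.card Λ.card hcard hΛn (by
          have := (abs_lt.1 (not_le.1 ht)).2
          linarith)
        simp only [hdec, ht]; simp [hb]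
    · rw [if_neg hdec, if_neg hdec]
      split_ifs <;> simp [hw]
  have hmul : ∑ m₁, ∑ m₂, ∑ u, ∑ v, enc m₁ m₂ u v * (1 - n / c ^ 2 - ∑ L : Finset (Fin n),
      D L.card * (if L ⊆ livePositions u v ∧ g₁ (survivors (firstBits u) L) = some m₁ ∧
          g₂ (survivors (firstBits v) L) = some m₂ then 1 else 0)) =
      (K₁ : ℝ) * K₂ * (1 - n / c ^ 2) - ∑ L : Finset (Fin n), D L.card *
        decodedMass enc g₁ g₂ L := by
    have : ∀ (m₁ : Fin K₁) (m₂ : Fin K₂),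
        ∑ u, ∑ v, enc m₁ m₂ u v * (1 - n / c ^ 2) = 1 - n / c ^ 2 := by
      intro m₁ m₂
      simp_rw [← Finset.sum_mul]
      rw [henc.2, one_mul]
    generalize (1 : ℝ) - n / c ^ 2 = x at this ⊢
    simp_rw [mul_sub, Finset.sum_sub_distrib, this]
    congr 1
    · simp [mul_assoc]
    · simp_rw [decodedMass, Finset.mul_sum]
      symm
      rw [Finset.sum_comm]
      refine Finset.sum_congr rfl fun m₁ _ => ?_
      rw [Finset.sum_comm]
      refine Finset.sum_congr rfl fun m₂ _ => ?_
      rw [Finset.sum_comm]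
      refine Finset.sum_congr rfl fun u _ => ?_
      rw [Finset.sum_comm]
      refine Finset.sum_congr rfl fun v _ => Finset.sum_congr rfl fun L _ => ?_
      split_ifs <;> simp [mul_comm]
  have hfin : (K₁ : ℝ) * K₂ * (1 - n / c ^ 2) - ∑ L : Finset (Fin n), D L.card *
        decodedMass enc g₁ g₂ L ≤ ∑ m₁, ∑ m₂, ∑ u, ∑ v, enc m₁ m₂ u v *
        ∑ L ∈ (livePositions u v).powerset,
          ε ^ L.card * (1 - ε) ^ ((livePositions u v).card - L.card) *
          (if g₁ (survivors (firstBits u) L) = some m₁ ∧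
            g₂ (survivors (firstBits v) L) = some m₂ then 0 else 1) := by
    rw [← hmul]
    gcongr with m₁ _ m₂ _ u _ v _
    · exact henc.1 _ _ _ _
    · exact key _ _ _ _
  rw [errorProb_eq]
  have h3 := mul_le_mul_of_nonneg_left hfin (inv_nonneg.2 hK.le)
  rw [mul_sub, ← mul_assoc, inv_mul_cancel₀ hK.ne', one_mul] at h3
  linarith

/-- Replacing the error message by a default guess makes the decoders total and can only add
nonnegative terms. -/
lemma decodedMass_mono_decoder {K₁ K₂ n : ℕ} {enc : Encoding K₁ K₂ n} (henc : IsStochastic enc)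
    (g₁ : (Fin n → OutLetter) → Option (Fin K₁)) (g₂ : (Fin n → OutLetter) → Option (Fin K₂))
    (k₁ : Fin K₁) (k₂ : Fin K₂) (L : Finset (Fin n)) :
    decodedMass enc g₁ g₂ L ≤ ∑ m₁, ∑ m₂, ∑ u, ∑ v,
      if L ⊆ livePositions u v ∧ (g₁ (survivors (firstBits u) L)).getD k₁ = m₁ ∧
        (g₂ (survivors (firstBits v) L)).getD k₂ = m₂ then enc m₁ m₂ u v else 0 := by
  unfold decodedMass
  gcongr with m₁ _ m₂ _ u _ v _
  by_cases h : L ⊆ livePositions u v ∧ g₁ (survivors (firstBits u) L) = some m₁ ∧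
      g₂ (survivors (firstBits v) L) = some m₂
  · rw [if_pos h, if_pos (by simp [h])]
  · rw [if_neg h]
    split_ifs
    · exact henc.1 _ _ _ _
    · rfl

lemma sum_agree {n : ℕ} (r : Fin n → Bool) (L : Finset (Fin n)) :
    ∑ s : Fin n → Bool, (if ∀ i ∈ L, r i = s i then (1 : ℝ) else 0) = 2 ^ (n - L.card) := by
  have h : ∀ s : Fin n → Bool, (if ∀ i ∈ L, r i = s i then (1 : ℝ) else 0) =
      ∏ i, (if i ∈ L → r i = s i then (1 : ℝ) else 0) := by
    intro s
    rw [Finset.prod_ite_zero]; simp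
  simp_rw [h]
  rw [← Fintype.prod_sum (fun i b => if i ∈ L → r i = b then (1 : ℝ) else 0)]
  have h2 : ∀ i, ∑ b, (if i ∈ L → r i = b then (1 : ℝ) else 0) = if i ∈ L then 1 else 2 := by
    intro i
    by_cases hi : i ∈ L <;> simp [hi]
  simp_rw [h2, Finset.prod_ite]
  rw [Finset.prod_const_one, one_mul, Finset.prod_const]
  congr 1
  rw [Finset.filter_not, ← Finset.compl_eq_univ_sdiff, Finset.card_compl]
  simp

/-- The decoded mass, as an average over the bit strings that agree with the survivors. -/
lemma decodedMass_le {K₁ K₂ n : ℕ} {enc : Encoding K₁ K₂ n} (henc : IsStochastic enc)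
    (g₁ : (Fin n → OutLetter) → Option (Fin K₁)) (g₂ : (Fin n → OutLetter) → Option (Fin K₂))
    (k₁ : Fin K₁) (k₂ : Fin K₂) (L : Finset (Fin n)) :
    ∃ (h₁ : (Fin n → Bool) → Fin K₁) (h₂ : (Fin n → Bool) → Fin K₂),
    4 ^ (n - L.card) * decodedMass enc g₁ g₂ L ≤
      ∑ s : Fin n → Bool, ∑ t : Fin n → Bool, ∑ u, ∑ v,
        if L ⊆ livePositions u v ∧ (∀ i ∈ L, firstBits u i = s i) ∧
          (∀ i ∈ L, firstBits v i = t i) then enc (h₁ s) (h₂ t) u v else 0 := by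
  refine ⟨fun s => (g₁ (survivors s L)).getD k₁, fun t => (g₂ (survivors t L)).getD k₂, ?_⟩
  refine (mul_le_mul_of_nonneg_left (decodedMass_mono_decoder henc g₁ g₂ k₁ k₂ L)
    (by positivity)).trans (le_of_eq ?_)
  have e1 : ∀ u v : Fin n → InLetter, ∑ m₁, ∑ m₂,
      (if L ⊆ livePositions u v ∧ (g₁ (survivors (firstBits u) L)).getD k₁ = m₁ ∧
        (g₂ (survivors (firstBits v) L)).getD k₂ = m₂ then enc m₁ m₂ u v else 0) =
      if L ⊆ livePositions u v then enc ((g₁ (survivors (firstBits u) L)).getD k₁)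
        ((g₂ (survivors (firstBits v) L)).getD k₂) u v else 0 := by
    intro u v
    by_cases h : L ⊆ livePositions u v <;> simp [h, ite_and]
  -- Full strings replace strings on L: each codeword pair is counted once for every extension of
  -- its two visible strings, whence 4^(n-|L|). The decoders see only the part on L.
  have e2 : ∀ u v : Fin n → InLetter, ∑ s : Fin n → Bool, ∑ t : Fin n → Bool,
      (if L ⊆ livePositions u v ∧ (∀ i ∈ L, firstBits u i = s i) ∧
          (∀ i ∈ L, firstBits v i = t i) then
        enc ((g₁ (survivors s L)).getD k₁) ((g₂ (survivors t L)).getD k₂) u v else 0) =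
      4 ^ (n - L.card) *
      if L ⊆ livePositions u v then enc ((g₁ (survivors (firstBits u) L)).getD k₁)
        ((g₂ (survivors (firstBits v) L)).getD k₂) u v else 0 := by
    intro u v
    have h4 : (4 : ℝ) ^ (n - L.card) = 2 ^ (n - L.card) * 2 ^ (n - L.card) := by
      rw [← mul_pow]; norm_num
    rw [h4]
    nth_rewrite 1 [← sum_agree (firstBits u) L]
    rw [← sum_agree (firstBits v) L, Finset.sum_mul_sum, Finset.sum_mul]
    refine Finset.sum_congr rfl fun s _ => ?_
    rw [Finset.sum_mul]
    refine Finset.sum_congr rfl fun t _ => ?_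
    by_cases hs : ∀ i ∈ L, firstBits u i = s i
    · by_cases ht : ∀ i ∈ L, firstBits v i = t i
      · rw [survivors_congr hs, survivors_congr ht]
        rw [if_pos hs, if_pos ht, one_mul, one_mul]
        exact if_congr ⟨fun h => h.1, fun h => ⟨h, hs, ht⟩⟩ rfl rfl
      · simp [ht]
    · simp [hs]
  have swap : ∀ {α β : Type} [Fintype α] [Fintype β]
      (f : α → β → (Fin n → InLetter) → (Fin n → InLetter) → ℝ),
      ∑ a, ∑ b, ∑ u, ∑ v, f a b u v = ∑ u, ∑ v, ∑ a, ∑ b, f a b u v := by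
    intro α β _ _ f
    have := Finset.sum_comm (s := Finset.univ (α := α × β))
      (t := Finset.univ (α := (Fin n → InLetter) × (Fin n → InLetter)))
      (f := fun p q => f p.1 p.2 q.1 q.2)
    simpa only [Fintype.sum_prod_type] using this
  rw [swap, swap]
  simp_rw [e1, e2, Finset.mul_sum]

lemma decodedMass_le_four_pow {K₁ K₂ n : ℕ} {enc : Encoding K₁ K₂ n} (henc : IsStochastic enc)
    (g₁ : (Fin n → OutLetter) → Option (Fin K₁)) (g₂ : (Fin n → OutLetter) → Option (Fin K₂))
    (k₁ : Fin K₁) (k₂ : Fin K₂) (L : Finset (Fin n)) :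
    decodedMass enc g₁ g₂ L ≤ 4 ^ L.card := by
  obtain ⟨h₁, h₂, h⟩ := decodedMass_le henc g₁ g₂ k₁ k₂ L
  have hL : L.card ≤ n := by simpa using Finset.card_le_univ L
  have h4 : (4 : ℝ) ^ (n - L.card) * 4 ^ L.card = 2 ^ n * 2 ^ n := by
    rw [← pow_add, Nat.sub_add_cancel hL, ← mul_pow]; norm_num
  refine le_of_mul_le_mul_left (h.trans ?_) (by positivity : (0 : ℝ) < 4 ^ (n - L.card))
  rw [h4]
  calc _ ≤ ∑ s : Fin n → Bool, ∑ t : Fin n → Bool, ∑ u, ∑ v, enc (h₁ s) (h₂ t) u v := by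
        gcongr with s _ t _ u _ v _
        split_ifs
        · rfl
        · exact henc.1 _ _ _ _
    _ = _ := by simp [henc.2]

/-! ### Bias of products of CHSH games -/

/-- The sign character of a bit. -/
def bitSign (b : Bool) : ℝ := if b then -1 else 1

/-- The characters of the `n`-fold CHSH game: `S` selects the coordinates that enter. -/
def chshSign {n : ℕ} (S : Finset (Fin n)) (s t : Fin n → Bool) : ℝ :=
  ∏ i ∈ S, bitSign (s i && t i)

lemma abs_bitSign (b : Bool) : |bitSign b| = 1 := by cases b <;> simp [bitSign]

lemma sum_chshSign_mul {n : ℕ} (S : Finset (Fin n)) (t t' : Fin n → Bool) :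
    ∑ s, chshSign S s t * chshSign S s t' = 2 ^ n * if ∀ i ∈ S, t i = t' i then 1 else 0 := by
  have h : ∀ s : Fin n → Bool, chshSign S s t * chshSign S s t' =
      ∏ i, (if i ∈ S then bitSign (s i && t i) * bitSign (s i && t' i) else 1) := by
    intro s
    rw [Finset.prod_ite_mem, Finset.univ_inter, Finset.prod_mul_distrib]; rfl
  simp_rw [h]
  rw [← Fintype.prod_sum
    (fun i b => if i ∈ S then bitSign (b && t i) * bitSign (b && t' i) else 1)]
  have h2 : ∀ i, ∑ b, (if i ∈ S then bitSign (b && t i) * bitSign (b && t' i) else 1) =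
      2 * if i ∈ S → t i = t' i then 1 else 0 := by
    intro i
    by_cases hi : i ∈ S <;> simp [hi]
    · cases t i <;> cases t' i <;> norm_num [bitSign]
  simp_rw [h2, Finset.prod_mul_distrib, Finset.prod_ite_zero]
  simp

/-- A Cauchy–Schwarz bound for the bias of a product of CHSH games. -/
lemma sum_chshSign_inner_le {V : Type*} [NormedAddCommGroup V] [InnerProductSpace ℝ V] {n : ℕ}
    (S : Finset (Fin n)) (x y : (Fin n → Bool) → V) (hx : ∀ s, ‖x s‖ ≤ 1) (hy : ∀ t, ‖y t‖ ≤ 1) :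
    ∑ s, ∑ t, chshSign S s t * inner ℝ (x s) (y t) ≤ 4 ^ n * (√2 / 2) ^ S.card := by
  have hS : S.card ≤ n := by simpa using Finset.card_le_univ S
  set z : (Fin n → Bool) → V := fun s => ∑ t, chshSign S s t • y t with hz
  have h1 : ∑ s, ∑ t, chshSign S s t * inner ℝ (x s) (y t) = ∑ s, inner ℝ (x s) (z s) := by
    refine Finset.sum_congr rfl fun s _ => ?_
    simp [hz, inner_sum, inner_smul_right]
  have h2 : ∑ s, inner ℝ (x s) (z s) ≤ ∑ s, ‖z s‖ := by
    refine Finset.sum_le_sum fun s _ => (real_inner_le_norm _ _).trans ?_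
    exact mul_le_of_le_one_left (norm_nonneg _) (hx s)
  -- Columns t, t' of the sign matrix are orthogonal unless they agree on S, so each t meets only
  -- 2^(n-|S|) columns t' with a nonzero contribution.
  have h3 : ∑ s, ‖z s‖ ^ 2 ≤ 2 ^ n * (2 ^ n * 2 ^ (n - S.card)) := by
    have e : ∀ s, ‖z s‖ ^ 2 =
        ∑ t, ∑ t', (chshSign S s t * chshSign S s t') * inner ℝ (y t) (y t') := by
      intro s
      rw [← real_inner_self_eq_norm_sq]
      simp only [hz, inner_sum, sum_inner, inner_smul_right, real_inner_smul_left]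
      simp_rw [Finset.mul_sum]
      rw [Finset.sum_comm]
      simp_rw [mul_left_comm, mul_assoc]
    simp_rw [e]
    rw [Finset.sum_comm]
    calc _ = ∑ t, ∑ t', (2 ^ n * if ∀ i ∈ S, t i = t' i then 1 else 0) *
          inner ℝ (y t) (y t') := by
          refine Finset.sum_congr rfl fun t _ => ?_
          rw [Finset.sum_comm]
          refine Finset.sum_congr rfl fun t' _ => ?_
          rw [← sum_chshSign_mul, Finset.sum_mul]
      _ ≤ ∑ t : Fin n → Bool, ∑ t' : Fin n → Bool,
          (2 ^ n * if ∀ i ∈ S, t i = t' i then 1 else 0) * 1 := by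
          gcongr with t _ t' _
          refine (real_inner_le_norm _ _).trans ?_
          exact mul_le_one₀ (hy t) (norm_nonneg _) (hy t')
      _ = _ := by
          simp_rw [mul_one, ← Finset.mul_sum, sum_agree]
          simp
  -- Cauchy–Schwarz over the 2^n strings s gives 16^n 2^(-|S|).
  have h4 : (∑ s, ‖z s‖) ^ 2 ≤ (4 ^ n * (√2 / 2) ^ S.card) ^ 2 := by
    have := sq_sum_le_card_mul_sum_sq (s := Finset.univ) (f := fun s => ‖z s‖)
    refine this.trans ?_
    have hq : ((√2 / 2) ^ S.card) ^ 2 = ((2 : ℝ) ^ S.card)⁻¹ := by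
      rw [← pow_mul, mul_comm, pow_mul, div_pow, Real.sq_sqrt (by norm_num), ← inv_pow]
      norm_num
    rw [mul_pow, hq]
    have hp : (2 : ℝ) ^ (n - S.card) = 2 ^ n * ((2 : ℝ) ^ S.card)⁻¹ := pow_sub₀ _ (by norm_num) hS
    have h42 : (4 : ℝ) ^ n = 2 ^ n * 2 ^ n := by rw [← mul_pow]; norm_num
    rw [hp] at h3
    rw [h42]
    simp only [Finset.card_univ, Fintype.card_fun, Fintype.card_bool, Fintype.card_fin,
      Nat.cast_pow, Nat.cast_ofNat]
    calc _ ≤ (2 : ℝ) ^ n * (2 ^ n * (2 ^ n * (2 ^ n * ((2 : ℝ) ^ S.card)⁻¹))) := by gcongr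
      _ = _ := by ring
  rw [h1]
  exact h2.trans ((le_abs_self _).trans (abs_le_of_sq_le_sq h4 (by positivity)))

/-! ### Quantum correlations as inner products -/

section Operators

variable {ι : Type} [Fintype ι]

/-- With X = ∑ c_a E_a and ∑ E_a = 1, one has 1 - X² = ∑ (c_a - X) E_a (c_a - X) + ∑ (1 - c_a²) E_a,
and every summand is positive semidefinite. -/
lemma Matrix.PosSemidef.one_sub_combination_sq [DecidableEq ι] {α : Type} [Fintype α] {E : α → Matrix ι ι ℂ}
    (hE : ∀ a, (E a).PosSemidef) (hsum : ∑ a, E a = 1) {c : α → ℝ} (hc : ∀ a, |c a| ≤ 1) :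
    (1 - (∑ a, (c a : ℂ) • E a)ᴴ * ∑ a, (c a : ℂ) • E a).PosSemidef := by
  set X := ∑ a, (c a : ℂ) • E a with hX
  have hXh : Xᴴ = X := by
    rw [hX, Matrix.conjTranspose_sum]
    refine Finset.sum_congr rfl fun a _ => ?_
    rw [Matrix.conjTranspose_smul, (hE a).1]; simp
  have e : 1 - Xᴴ * X = ∑ a, (((c a : ℂ) • (1 : Matrix ι ι ℂ) - X)ᴴ * E a *
      ((c a : ℂ) • (1 : Matrix ι ι ℂ) - X) + ((1 - c a ^ 2 : ℝ) : ℂ) • E a) := by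
    have h : ∀ a, ((c a : ℂ) • (1 : Matrix ι ι ℂ) - X)ᴴ * E a *
        ((c a : ℂ) • (1 : Matrix ι ι ℂ) - X) + ((1 - c a ^ 2 : ℝ) : ℂ) • E a =
        E a - (X * ((c a : ℂ) • E a) + ((c a : ℂ) • E a) * X) + X * E a * X := by
      intro a
      rw [Matrix.conjTranspose_sub, Matrix.conjTranspose_smul, hXh]
      simp only [Matrix.conjTranspose_one, sub_mul, mul_sub, Matrix.smul_mul, Matrix.mul_smul,
        one_mul, mul_one, Complex.star_def, Complex.conj_ofReal, Complex.ofReal_sub,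
        Complex.ofReal_one, Complex.ofReal_mul, sub_smul, smul_smul, pow_two, one_smul,
        Matrix.mul_assoc]
      abel
    simp_rw [h]
    rw [Finset.sum_add_distrib, Finset.sum_sub_distrib, Finset.sum_add_distrib, ← Finset.mul_sum,
      ← Finset.sum_mul, ← Finset.sum_mul, ← Finset.mul_sum, hsum, ← hX, hXh]
    simp only [mul_one]
    abel
  rw [e]
  refine Matrix.posSemidef_sum _ fun a _ => ?_
  refine ((hE a).conjTranspose_mul_mul_same _).add ((hE a).smul ?_)
  rw [Complex.zero_le_real]
  have := (sq_le_one_iff_abs_le_one (c a)).2 (hc a)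
  linarith

/-- The entries of a matrix as a vector of a Hilbert space. -/
def entryVector (P : Matrix ι ι ℂ) : EuclideanSpace ℂ (ι × ι) := WithLp.toLp 2 fun p => P p.1 p.2

lemma inner_entryVector (P Q : Matrix ι ι ℂ) :
    inner ℝ (entryVector P) (entryVector Q) = (Pᴴ * Q).trace.re := by
  simp only [entryVector, PiLp.inner_apply, Complex.inner, Fintype.sum_prod_type,
    Matrix.trace, Matrix.diag, Matrix.mul_apply, Matrix.conjTranspose_apply, Complex.re_sum]
  rw [Finset.sum_comm]
  simp [mul_comm]

lemma Matrix.PosSemidef.exists_eq_conjTranspose_mul_self [DecidableEq ι] {ρ : Matrix ι ι ℂ}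
    (hρ : ρ.PosSemidef) : ∃ C : Matrix ι ι ℂ, ρ = Cᴴ * C := by
  open scoped MatrixOrder in
  exact CStarAlgebra.nonneg_iff_eq_star_mul_self.mp hρ.nonneg

lemma inner_entryVector_mul (C M N : Matrix ι ι ℂ) (hM : Mᴴ = M) :
    inner ℝ (entryVector (M * Cᴴ)) (entryVector (N * Cᴴ)) = (Cᴴ * C * (M * N)).trace.re := by
  rw [inner_entryVector, Matrix.conjTranspose_mul, Matrix.conjTranspose_conjTranspose, hM,
    Matrix.mul_assoc Cᴴ C, Matrix.trace_mul_comm Cᴴ]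
  simp only [Matrix.mul_assoc]

lemma norm_entryVector_mul_le [DecidableEq ι] (C M : Matrix ι ι ℂ) (hC : (Cᴴ * C).trace = 1)
    (hM : Mᴴ = M) (hM1 : (1 - Mᴴ * M).PosSemidef) : ‖entryVector (M * Cᴴ)‖ ≤ 1 := by
  have h := (hM1.mul_mul_conjTranspose_same C).trace_nonneg
  have h2 : ‖entryVector (M * Cᴴ)‖ ^ 2 ≤ 1 := by
    rw [← real_inner_self_eq_norm_sq, inner_entryVector_mul _ _ _ hM]
    have e : (C * (1 - Mᴴ * M) * Cᴴ).trace = 1 - (Cᴴ * C * (M * M)).trace := by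
      rw [mul_sub, sub_mul, Matrix.trace_sub, mul_one, Matrix.trace_mul_comm C Cᴴ, hC, hM,
        Matrix.mul_assoc Cᴴ, Matrix.trace_mul_comm Cᴴ]
    rw [e] at h
    have := (Complex.le_def.1 h).1
    simp at this
    linarith
  exact (sq_le_one_iff₀ (norm_nonneg _)).1 h2

lemma trace_mul_posSemidef_nonneg [DecidableEq ι] {ρ M : Matrix ι ι ℂ}
    (hρ : ρ.PosSemidef) (hM : M.PosSemidef) : 0 ≤ (ρ * M).trace.re := by
  obtain ⟨C, rfl⟩ := hρ.exists_eq_conjTranspose_mul_self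
  have h := (hM.mul_mul_conjTranspose_same C).trace_nonneg
  rw [Matrix.trace_mul_comm, ← Matrix.mul_assoc] at h
  exact (Complex.le_def.1 h).1

end Operators

lemma entanglementAssisted_combination {K₁ K₂ n d₁ d₂ : ℕ} {enc : Encoding K₁ K₂ n}
    {ρ : Matrix (Fin d₁ × Fin d₂) (Fin d₁ × Fin d₂) ℂ}
    {A : Fin K₁ → (Fin n → InLetter) → Matrix (Fin d₁) (Fin d₁) ℂ}
    {B : Fin K₂ → (Fin n → InLetter) → Matrix (Fin d₂) (Fin d₂) ℂ}
    (h : ∀ m₁ m₂ u v, enc m₁ m₂ u v = (ρ * (A m₁ u ⊗ₖ B m₂ v)).trace.re) (m₁ : Fin K₁)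
    (m₂ : Fin K₂) (c c' : (Fin n → InLetter) → ℝ) :
    ∑ u, ∑ v, c u * c' v * enc m₁ m₂ u v =
      (ρ * ((∑ u, (c u : ℂ) • (A m₁ u ⊗ₖ (1 : Matrix (Fin d₂) (Fin d₂) ℂ))) *
        ∑ v, (c' v : ℂ) • ((1 : Matrix (Fin d₁) (Fin d₁) ℂ) ⊗ₖ B m₂ v))).trace.re := by
  simp_rw [Finset.sum_mul_sum, Finset.mul_sum, Matrix.trace_sum, Complex.re_sum, h]
  refine Finset.sum_congr rfl fun u _ => Finset.sum_congr rfl fun v _ => ?_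
  rw [Matrix.smul_mul, Matrix.mul_smul _ (c' v : ℂ), ← Matrix.mul_kronecker_mul, Matrix.mul_one,
    Matrix.one_mul, smul_smul, Matrix.mul_smul, Matrix.trace_smul, ← Complex.ofReal_mul,
    smul_eq_mul, Complex.re_ofReal_mul]

lemma entanglementAssisted.isStochastic {K₁ K₂ n : ℕ} {enc : Encoding K₁ K₂ n}
    (h : entanglementAssisted K₁ K₂ n enc) : IsStochastic enc := by
  obtain ⟨d₁, d₂, ρ, A, B, hρ, htr, hA, hB, he⟩ := h
  refine ⟨fun m₁ m₂ u v => ?_, fun m₁ m₂ => ?_⟩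
  · rw [he]
    exact trace_mul_posSemidef_nonneg hρ (((hA m₁).1 u).kronecker ((hB m₂).1 v))
  · have := entanglementAssisted_combination he m₁ m₂ (fun _ => 1) (fun _ => 1)
    simp only [one_mul, Complex.ofReal_one, one_smul] at this
    rw [this]
    have e1 : ∑ u, A m₁ u ⊗ₖ (1 : Matrix (Fin d₂) (Fin d₂) ℂ) = 1 := by
      rw [← Matrix.one_kronecker_one, ← (hA m₁).2]
      ext; simp [Matrix.sum_apply, Finset.sum_mul]
    have e2 : ∑ v, (1 : Matrix (Fin d₁) (Fin d₁) ℂ) ⊗ₖ B m₂ v = 1 := by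
      rw [← Matrix.one_kronecker_one, ← (hB m₂).2]
      ext; simp [Matrix.sum_apply, Finset.mul_sum]
    rw [e1, e2]; simp [htr]

/-- The correlations of an entanglement-assisted encoding are inner products of vectors that
depend on one message only. -/
lemma entanglementAssisted.exists_vectors {K₁ K₂ n : ℕ} {enc : Encoding K₁ K₂ n}
    (h : entanglementAssisted K₁ K₂ n enc) :
    ∃ (ι : Type) (_ : Fintype ι)
      (x : Fin K₁ → ((Fin n → InLetter) → ℝ) → EuclideanSpace ℂ ι)
      (y : Fin K₂ → ((Fin n → InLetter) → ℝ) → EuclideanSpace ℂ ι),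
      (∀ m c, (∀ u, |c u| ≤ 1) → ‖x m c‖ ≤ 1) ∧ (∀ m c, (∀ v, |c v| ≤ 1) → ‖y m c‖ ≤ 1) ∧
      ∀ m₁ m₂ c c', ∑ u, ∑ v, c u * c' v * enc m₁ m₂ u v = inner ℝ (x m₁ c) (y m₂ c') := by
  obtain ⟨d₁, d₂, ρ, A, B, hρ, htr, hA, hB, he⟩ := h
  -- With ρ = C*C, the correlation Tr(ρMN) is the inner product of the entry vectors of MC* and NC*,
  -- where M and N each involve one sender's measurement only.
  obtain ⟨C, rfl⟩ := hρ.exists_eq_conjTranspose_mul_self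
  have hA' : ∀ m u, (A m u ⊗ₖ (1 : Matrix (Fin d₂) (Fin d₂) ℂ)).PosSemidef :=
    fun m u => ((hA m).1 u).kronecker Matrix.PosSemidef.one
  have hB' : ∀ m v, ((1 : Matrix (Fin d₁) (Fin d₁) ℂ) ⊗ₖ B m v).PosSemidef :=
    fun m v => Matrix.PosSemidef.one.kronecker ((hB m).1 v)
  have e1 : ∀ m, ∑ u, A m u ⊗ₖ (1 : Matrix (Fin d₂) (Fin d₂) ℂ) = 1 := by
    intro m
    rw [← Matrix.one_kronecker_one, ← (hA m).2]
    ext; simp [Matrix.sum_apply, Finset.sum_mul]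
  have e2 : ∀ m, ∑ v, (1 : Matrix (Fin d₁) (Fin d₁) ℂ) ⊗ₖ B m v = 1 := by
    intro m
    rw [← Matrix.one_kronecker_one, ← (hB m).2]
    ext; simp [Matrix.sum_apply, Finset.mul_sum]
  have herm : ∀ {α : Type} [Fintype α]
      (E : α → Matrix (Fin d₁ × Fin d₂) (Fin d₁ × Fin d₂) ℂ) (c : α → ℝ),
      (∀ a, (E a).PosSemidef) → (∑ a, (c a : ℂ) • E a)ᴴ = ∑ a, (c a : ℂ) • E a := by
    intro α _ E c hE
    rw [Matrix.conjTranspose_sum]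
    refine Finset.sum_congr rfl fun a _ => ?_
    rw [Matrix.conjTranspose_smul, (hE a).1]; simp
  refine ⟨(Fin d₁ × Fin d₂) × (Fin d₁ × Fin d₂), inferInstance,
    fun m c => entryVector ((∑ u, (c u : ℂ) • (A m u ⊗ₖ (1 : Matrix (Fin d₂) (Fin d₂) ℂ))) * Cᴴ),
    fun m c => entryVector ((∑ v, (c v : ℂ) • ((1 : Matrix (Fin d₁) (Fin d₁) ℂ) ⊗ₖ B m v)) * Cᴴ),
    fun m c hc => ?_, fun m c hc => ?_, fun m₁ m₂ c c' => ?_⟩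
  · exact norm_entryVector_mul_le _ _ htr (herm _ _ (hA' m))
      (Matrix.PosSemidef.one_sub_combination_sq (hA' m) (e1 m) hc)
  · exact norm_entryVector_mul_le _ _ htr (herm _ _ (hB' m))
      (Matrix.PosSemidef.one_sub_combination_sq (hB' m) (e2 m) hc)
  · rw [inner_entryVector_mul _ _ _ (herm _ _ (hA' m₁))]
    exact entanglementAssisted_combination he m₁ m₂ c c'

/-! ### Tsirelson's bound for the decoded mass -/

/-- Being live at a position has indicator (1 + (-1)^(st) (-1)^(a₁+a₂))/2. Expanding the product
over L gives one term per subset S, whose codeword factors separate between the senders. -/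
lemma live_indicator {n : ℕ} (L : Finset (Fin n)) (u v : Fin n → InLetter) (s t : Fin n → Bool) :
    (if L ⊆ livePositions u v ∧ (∀ i ∈ L, firstBits u i = s i) ∧
      (∀ i ∈ L, firstBits v i = t i) then (1 : ℝ) else 0) =
    (1 / 2) ^ L.card * ∑ S ∈ L.powerset, chshSign S s t *
      (((if ∀ i ∈ L, firstBits u i = s i then 1 else 0) * ∏ i ∈ S, bitSign (u i).2) *
       ((if ∀ i ∈ L, firstBits v i = t i then 1 else 0) * ∏ i ∈ S, bitSign (v i).2)) := by
  by_cases hs : ∀ i ∈ L, firstBits u i = s i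
  · by_cases ht : ∀ i ∈ L, firstBits v i = t i
    · have e : ∑ S ∈ L.powerset, chshSign S s t *
          (((if ∀ i ∈ L, firstBits u i = s i then 1 else 0) * ∏ i ∈ S, bitSign (u i).2) *
          ((if ∀ i ∈ L, firstBits v i = t i then 1 else 0) * ∏ i ∈ S, bitSign (v i).2)) =
          ∏ i ∈ L, (1 + bitSign (s i && t i) * (bitSign (u i).2 * bitSign (v i).2)) := by
        rw [Finset.prod_one_add]
        refine Finset.sum_congr rfl fun S _ => ?_
        rw [if_pos hs, if_pos ht, one_mul, one_mul, Finset.prod_mul_distrib,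
          Finset.prod_mul_distrib]; rfl
      rw [e, ← Finset.prod_const, ← Finset.prod_mul_distrib]
      have e2 : ∀ i ∈ L, (1 / 2 : ℝ) * (1 + bitSign (s i && t i) *
          (bitSign (u i).2 * bitSign (v i).2)) = if IsLive (u i) (v i) then 1 else 0 := by
        intro i hi
        have h1 : (u i).1 = s i := hs i hi
        have h2 : (v i).1 = t i := ht i hi
        simp only [IsLive, h1, h2]
        cases s i <;> cases t i <;> cases (u i).2 <;> cases (v i).2 <;> norm_num [bitSign]
      rw [Finset.prod_congr rfl e2]
      by_cases hl : L ⊆ livePositions u v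
      · rw [if_pos ⟨hl, hs, ht⟩, Finset.prod_eq_one fun i hi => ?_]
        simpa [livePositions] using hl hi
      · rw [if_neg fun h => hl h.1]
        obtain ⟨i, hi, hil⟩ := Finset.not_subset.1 hl
        exact (Finset.prod_eq_zero hi (by simpa [livePositions] using hil)).symm
    · simp [ht]
  · simp [hs]

/-- Tsirelson's bound for the product of the CHSH games at the positions in `L`. -/
lemma entanglementAssisted.decodedMass_le {K₁ K₂ n : ℕ} {enc : Encoding K₁ K₂ n}
    (henc : entanglementAssisted K₁ K₂ n enc)
    (g₁ : (Fin n → OutLetter) → Option (Fin K₁)) (g₂ : (Fin n → OutLetter) → Option (Fin K₂))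
    (k₁ : Fin K₁) (k₂ : Fin K₂) (L : Finset (Fin n)) :
    decodedMass enc g₁ g₂ L ≤ (2 + √2) ^ L.card := by
  obtain ⟨h₁, h₂, h⟩ := _root_.decodedMass_le henc.isStochastic g₁ g₂ k₁ k₂ L
  obtain ⟨ι, _, x, y, hx, hy, hxy⟩ := henc.exists_vectors
  have hL : L.card ≤ n := by simpa using Finset.card_le_univ L
  refine le_of_mul_le_mul_left (h.trans ?_) (by positivity : (0 : ℝ) < 4 ^ (n - L.card))
  -- The factor of one sender in the term S of `live_indicator`; its absolute value is at most 1, so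
  -- the vector bounds apply.
  let c : Finset (Fin n) → (Fin n → Bool) → (Fin n → InLetter) → ℝ := fun S s u =>
    (if ∀ i ∈ L, firstBits u i = s i then 1 else 0) * ∏ i ∈ S, bitSign (u i).2
  have hc : ∀ S s u, |c S s u| ≤ 1 := by
    intro S s u
    simp only [c, abs_mul, Finset.abs_prod, abs_bitSign, Finset.prod_const_one, mul_one]
    split_ifs <;> simp
  have e : ∀ s t, (∑ u, ∑ v, if L ⊆ livePositions u v ∧ (∀ i ∈ L, firstBits u i = s i) ∧
          (∀ i ∈ L, firstBits v i = t i) then enc (h₁ s) (h₂ t) u v else 0) =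
      (1 / 2) ^ L.card * ∑ S ∈ L.powerset, chshSign S s t *
        inner ℝ (x (h₁ s) (c S s)) (y (h₂ t) (c S t)) := by
    intro s t
    simp_rw [← hxy, Finset.mul_sum]
    symm
    rw [Finset.sum_comm]
    refine Finset.sum_congr rfl fun u _ => ?_
    rw [Finset.sum_comm]
    refine Finset.sum_congr rfl fun v _ => ?_
    have := congrArg (· * enc (h₁ s) (h₂ t) u v) (live_indicator L u v s t)
    simp only [ite_mul, one_mul, zero_mul] at this
    rw [this, Finset.mul_sum, Finset.sum_mul]
    refine Finset.sum_congr rfl fun S _ => ?_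
    simp only [c]
    split_ifs <;> ring
  simp_rw [e, ← Finset.mul_sum]
  have e3 : ∑ s, ∑ t, ∑ S ∈ L.powerset, chshSign S s t *
        inner ℝ (x (h₁ s) (c S s)) (y (h₂ t) (c S t)) =
      ∑ S ∈ L.powerset, ∑ s, ∑ t, chshSign S s t *
        inner ℝ (x (h₁ s) (c S s)) (y (h₂ t) (c S t)) := by
    rw [Finset.sum_congr rfl fun s _ => Finset.sum_comm, Finset.sum_comm]
  rw [e3]
  calc _ ≤ (1 / 2 : ℝ) ^ L.card * ∑ S ∈ L.powerset, 4 ^ n * (√2 / 2) ^ S.card := by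
        gcongr with S _
        exact sum_chshSign_inner_le S _ _ (fun s => hx _ _ (hc S s)) (fun t => hy _ _ (hc S t))
    -- The sum over S is the binomial expansion of (1 + √2/2)^|L|, and 4 · (1/2) · (1 + √2/2) = 2 +
    -- √2.
    _ = 4 ^ (n - L.card) * (4 ^ L.card * (1 / 2) ^ L.card * (√2 / 2 + 1) ^ L.card) := by
        have h4 : (4 : ℝ) ^ n = 4 ^ (n - L.card) * 4 ^ L.card := by
          rw [← pow_add, Nat.sub_add_cancel hL]
        rw [← Finset.mul_sum, ← Finset.sum_pow_mul_eq_add_pow, h4]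
        simp only [one_pow, mul_one]
        ring
    _ = _ := by
        rw [← mul_pow, ← mul_pow]
        congr 2
        ring

/-! ### From success bounds to rate bounds -/

lemma exp_le_messageCount (n : ℕ) (R : ℝ) :
    Real.exp (n * (R * Real.log 2)) ≤ messageCount n R := by
  rw [messageCount, Nat.cast_pow, Nat.cast_ofNat, ← Real.rpow_natCast, Real.rpow_def_of_pos two_pos,
    Real.exp_le_exp]
  nlinarith [Nat.le_ceil ((n : ℝ) * R), Real.log_pos one_lt_two]

lemma messageCount_pos (n : ℕ) (R : ℝ) : 0 < messageCount n R := by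
  unfold messageCount; positivity

/-- A non-asymptotic bound on the success probability, turned into a bound on rates. -/
lemma Achievable.rate_le {𝓒 : EncodingClass} {ε a b R₁ R₂ : ℝ} (hb : 0 ≤ b)
    (hsucc : ∀ τ : ℝ, 0 < τ → ∀ K₁ K₂ n : ℕ, 0 < K₁ → 0 < K₂ → 0 < n →
      ∀ enc : Encoding K₁ K₂ n, 𝓒 K₁ K₂ n enc → ∀ g₁ g₂,
        1 - errorProb (channelII ε) enc g₁ g₂ ≤
          n / (τ * n) ^ 2 + ((K₁ : ℝ) * K₂)⁻¹ * Real.exp (n * (a + b * τ)))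
    (h : Achievable 𝓒 (channelII ε) R₁ R₂) : (R₁ + R₂) * Real.log 2 ≤ a := by
  obtain ⟨-, -, enc, g₁, g₂, henc, hlim⟩ := h
  by_contra! hlt
  set r := (R₁ + R₂) * Real.log 2 with hr
  -- Chosen so that bτ uses up less than the slack r - a; adding 1 to b avoids division by zero.
  set τ := (r - a) / (2 * (b + 1)) with hτ
  have hτ0 : 0 < τ := by have := sub_pos.2 hlt; positivity
  have hδ : 0 < r - a - b * τ := by
    have : τ * (2 * (b + 1)) = r - a := by rw [hτ]; field_simp
    nlinarith
  have h1 : Filter.Tendsto (fun n : ℕ => (τ ^ 2)⁻¹ * (n : ℝ)⁻¹ +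
      Real.exp (-((r - a - b * τ) * n))) Filter.atTop (nhds ((τ ^ 2)⁻¹ * 0 + 0)) := by
    refine (tendsto_inv_atTop_nhds_zero_nat.const_mul _).add ?_
    exact Real.tendsto_exp_neg_atTop_nhds_zero.comp
      (tendsto_natCast_atTop_atTop.const_mul_atTop hδ)
  have h2 : ∀ᶠ n : ℕ in Filter.atTop, 1 - errorProb (channelII ε) (enc n) (g₁ n) (g₂ n) ≤
      (τ ^ 2)⁻¹ * (n : ℝ)⁻¹ + Real.exp (-((r - a - b * τ) * n)) := by
    filter_upwards [Filter.eventually_gt_atTop 0] with n hn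
    refine (hsucc τ hτ0 _ _ n (messageCount_pos n R₁) (messageCount_pos n R₂) hn _ (henc n) _ _).trans
      (add_le_add (le_of_eq ?_) ?_)
    · have : (0 : ℝ) < n := by exact_mod_cast hn
      field_simp
    · have hK : Real.exp (n * r) ≤ (messageCount n R₁ : ℝ) * messageCount n R₂ := by
        rw [hr, add_mul, mul_add, Real.exp_add]
        exact mul_le_mul (exp_le_messageCount _ _) (exp_le_messageCount _ _)
          (Real.exp_pos _).le (by positivity)
      calc _ ≤ (Real.exp (n * r))⁻¹ * Real.exp (n * (a + b * τ)) := by gcongr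
        _ = _ := by rw [← Real.exp_neg, ← Real.exp_add]; congr 1; ring
  -- In the limit the success bound reads 1 ≤ 0.
  have h3 := le_of_tendsto_of_tendsto (tendsto_const_nhds.sub hlim) h1 h2
  norm_num at h3

/-- The senders could also leave positions dead and signal by the erasure pattern. For small ε this
does not pay: filling up k live positions to n costs a factor (1-ε)^(n-k) ≥ 4^(-ε(n-k)), and l ≤ εk
+ τn compensates it. -/
lemma success_le_of_isStochastic {ε τ : ℝ} (h0 : 0 ≤ ε) (h1 : ε ≤ 1 / 20) (hτ : 0 < τ)
    {K₁ K₂ n : ℕ} (hK₁ : 0 < K₁) (hK₂ : 0 < K₂) (hn : 0 < n) {enc : Encoding K₁ K₂ n}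
    (henc : IsStochastic enc)
    (g₁ : (Fin n → OutLetter) → Option (Fin K₁)) (g₂ : (Fin n → OutLetter) → Option (Fin K₂)) :
    1 - errorProb (channelII ε) enc g₁ g₂ ≤ n / (τ * n) ^ 2 + ((K₁ : ℝ) * K₂)⁻¹ *
      Real.exp (n * (2 * ε * Real.log 2 + 2 * Real.log 2 * τ)) := by
  have hn' : (0 : ℝ) < n := by exact_mod_cast hn
  have h1' : 0 < 1 - ε := by linarith
  set q := 2 * Real.log 2 with hq
  have hq1 : 1.38 ≤ q := by have := Real.log_two_gt_d9; rw [hq]; linarith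
  have hq4 : Real.exp q = 4 := by
    rw [hq, two_mul, Real.exp_add, Real.exp_log two_pos]; norm_num
  have hexp : Real.exp (-(q * ε)) ≤ 1 - ε := by
    rw [Real.exp_neg]
    refine inv_le_of_inv_le₀ h1' (le_trans ?_ (Real.add_one_le_exp _))
    rw [inv_le_iff_one_le_mul₀ h1']
    have : 1 ≤ q * (1 - ε) := by nlinarith
    nlinarith
  -- The factor 4^(-l) cancels the decoded mass, leaving binomial weights on all n positions, which
  -- sum to 1.
  let D : ℕ → ℝ := fun l =>
    ε ^ l * (1 - ε) ^ (n - l) * (Real.exp (q * (ε * n + τ * n)) * (4 ^ l)⁻¹)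
  have hD0 : ∀ l, 0 ≤ D l := fun l => by positivity
  refine (one_sub_errorProb_le hK₁ hK₂ h0 (by linarith) (mul_pos hτ hn') henc g₁ g₂ D hD0
    fun l k hlk hkn hl => ?_).trans ?_
  · simp only [D]
    have e : (1 - ε) ^ (n - l) = (1 - ε) ^ (k - l) * (1 - ε) ^ (n - k) := by
      rw [← pow_add]; congr 1; omega
    have h4 : ((4 : ℝ) ^ l)⁻¹ = Real.exp (-(q * l)) := by
      rw [← hq4, ← Real.exp_nat_mul, ← Real.exp_neg, mul_comm]
    have hb : Real.exp (-(q * ε) * (n - k : ℕ)) ≤ (1 - ε) ^ (n - k) := by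
      rw [mul_comm, Real.exp_nat_mul]; gcongr
    rw [e, h4, ← Real.exp_add]
    have : 1 ≤ (1 - ε) ^ (n - k) * Real.exp (q * (ε * n + τ * n) + -(q * l)) := by
      refine le_trans ?_ (mul_le_mul_of_nonneg_right hb (Real.exp_pos _).le)
      rw [← Real.exp_add]
      apply Real.one_le_exp
      rw [Nat.cast_sub hkn]
      nlinarith
    calc _ = ε ^ l * (1 - ε) ^ (k - l) * 1 := by ring
      _ ≤ ε ^ l * (1 - ε) ^ (k - l) *
          ((1 - ε) ^ (n - k) * Real.exp (q * (ε * n + τ * n) + -(q * l))) := by gcongr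
      _ = _ := by ring
  · gcongr
    calc _ ≤ ∑ L : Finset (Fin n), D L.card * 4 ^ L.card := by
          gcongr with L _
          exact decodedMass_le_four_pow henc g₁ g₂ ⟨0, hK₁⟩ ⟨0, hK₂⟩ L
      _ = ∑ L ∈ (Finset.univ : Finset (Fin n)).powerset, ε ^ L.card *
          (1 - ε) ^ ((Finset.univ : Finset (Fin n)).card - L.card) *
          Real.exp (q * (ε * n + τ * n)) := by
          rw [Finset.powerset_univ, Finset.card_univ, Fintype.card_fin]
          refine Finset.sum_congr rfl fun L _ => ?_
          simp only [D]
          field_simp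
      _ = _ := by
          rw [← Finset.sum_mul, sum_powerset_weight, one_mul, hq]
          congr 1; ring

lemma success_le_of_entanglementAssisted {ε τ : ℝ} (h0 : 0 ≤ ε) (h1 : ε ≤ 1) (hτ : 0 < τ)
    {K₁ K₂ n : ℕ} (hK₁ : 0 < K₁) (hK₂ : 0 < K₂) (hn : 0 < n) {enc : Encoding K₁ K₂ n}
    (henc : entanglementAssisted K₁ K₂ n enc)
    (g₁ : (Fin n → OutLetter) → Option (Fin K₁)) (g₂ : (Fin n → OutLetter) → Option (Fin K₂)) :
    1 - errorProb (channelII ε) enc g₁ g₂ ≤ n / (τ * n) ^ 2 + ((K₁ : ℝ) * K₂)⁻¹ *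
      Real.exp (n * (ε * Real.exp (-(1 - ε)) * (2 + √2) + 1 * τ)) := by
  have hn' : (0 : ℝ) < n := by exact_mod_cast hn
  -- From (1-ε)^(k-l) ≤ e^(-ε(k-l)) and εk ≥ l - τn the number k of live positions disappears.
  let D : ℕ → ℝ := fun l => Real.exp (τ * n) * (ε * Real.exp (-(1 - ε))) ^ l
  have hD0 : ∀ l, 0 ≤ D l := fun l => by positivity
  refine (one_sub_errorProb_le hK₁ hK₂ h0 h1 (mul_pos hτ hn') henc.isStochastic g₁ g₂ D hD0
    fun l k hlk hkn hl => ?_).trans ?_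
  · simp only [D]
    rw [mul_pow, ← Real.exp_nat_mul, mul_left_comm, ← Real.exp_add]
    gcongr
    calc (1 - ε) ^ (k - l) ≤ Real.exp (-ε) ^ (k - l) := by
          have := Real.one_sub_le_exp_neg ε
          have : 0 ≤ 1 - ε := by linarith
          gcongr
      _ ≤ _ := by
          rw [← Real.exp_nat_mul, Real.exp_le_exp, Nat.cast_sub hlk]
          nlinarith
  · gcongr
    calc _ ≤ ∑ L : Finset (Fin n), D L.card * (2 + √2) ^ L.card := by
          gcongr with L _
          exact henc.decodedMass_le g₁ g₂ ⟨0, hK₁⟩ ⟨0, hK₂⟩ L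
      _ = Real.exp (τ * n) * ∑ L ∈ (Finset.univ : Finset (Fin n)).powerset,
          (ε * Real.exp (-(1 - ε)) * (2 + √2)) ^ L.card *
          1 ^ ((Finset.univ : Finset (Fin n)).card - L.card) := by
          rw [Finset.powerset_univ, Finset.mul_sum]
          refine Finset.sum_congr rfl fun L _ => ?_
          simp only [D, one_pow, mul_one, mul_pow]
          ring
      _ = Real.exp (τ * n) * (ε * Real.exp (-(1 - ε)) * (2 + √2) + 1) ^ n := by
          rw [Finset.sum_pow_mul_eq_add_pow, Finset.card_univ, Fintype.card_fin]
      _ ≤ Real.exp (τ * n) * Real.exp (ε * Real.exp (-(1 - ε)) * (2 + √2)) ^ n := by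
          gcongr
          exact Real.add_one_le_exp _
      _ = _ := by
          rw [← Real.exp_nat_mul, ← Real.exp_add]
          congr 1; ring

/-- Numerically e^(-(1-ε)) (2+√2) ≤ 0.388 · 3.4143 < 1.325, while 1.98 log 2 > 1.372. -/
lemma tsirelson_exponent_le {ε : ℝ} (h0 : 0 ≤ ε) (h1 : ε ≤ 1 / 20) :
    ε * Real.exp (-(1 - ε)) * (2 + √2) ≤ 198 / 100 * ε * Real.log 2 := by
  have hs : √2 ≤ 1.4143 := by
    rw [Real.sqrt_le_left (by norm_num)]; norm_num
  have hl := Real.log_two_gt_d9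
  have he : Real.exp (-(1 - ε)) ≤ 0.388 := by
    have e1 : Real.exp (-(1 - ε)) = Real.exp ε * (Real.exp 1)⁻¹ := by
      rw [← Real.exp_neg, ← Real.exp_add]; congr 1; ring
    have e2 : Real.exp ε * (1 - ε) ≤ 1 := by
      have := Real.one_sub_le_exp_neg ε
      calc _ ≤ Real.exp ε * Real.exp (-ε) := by gcongr
        _ = 1 := by rw [← Real.exp_add]; simp
    have e3 : Real.exp ε ≤ 1.0527 := by nlinarith [Real.exp_pos ε]
    have e4 := Real.exp_one_gt_d9
    rw [e1, ← div_eq_mul_inv, div_le_iff₀ (Real.exp_pos 1)]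
    linarith
  have : Real.exp (-(1 - ε)) * (2 + √2) ≤ 198 / 100 * Real.log 2 := by
    calc Real.exp (-(1 - ε)) * (2 + √2) ≤ 0.388 * (2 + 1.4143) := by gcongr
      _ ≤ 198 / 100 * Real.log 2 := by norm_num at hl ⊢; linarith
  nlinarith

lemma sumCapacity_le {𝓒 : EncodingClass} {W : InterferenceChannel} {c : ℝ}
    (h : ∀ R₁ R₂, Achievable 𝓒 W R₁ R₂ → R₁ + R₂ ≤ c) : sumCapacity 𝓒 W ≤ (c : EReal) := by
  refine sSup_le ?_
  rintro s ⟨R₁, R₂, hR, rfl⟩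
  exact_mod_cast h R₁ R₂ hR

lemma sumCapacity_entanglementAssisted_le {ε : ℝ} (h0 : 0 ≤ ε) (h1 : ε ≤ 1 / 20) :
    sumCapacity entanglementAssisted (channelII ε) ≤ ((198 / 100 * ε : ℝ) : EReal) := by
  refine sumCapacity_le fun R₁ R₂ hR => ?_
  have := (hR.rate_le zero_le_one fun τ hτ K₁ K₂ n hK₁ hK₂ hn enc henc g₁ g₂ =>
    success_le_of_entanglementAssisted h0 (by linarith) hτ hK₁ hK₂ hn henc g₁ g₂).trans
      (tsirelson_exponent_le h0 h1)
  exact le_of_mul_le_mul_right this (Real.log_pos one_lt_two)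

lemma sumCapacity_le_two_mul {𝓒 : EncodingClass}
    (h𝓒 : ∀ K₁ K₂ n enc, 𝓒 K₁ K₂ n enc → IsStochastic enc) {ε : ℝ} (h0 : 0 ≤ ε)
    (h1 : ε ≤ 1 / 20) : sumCapacity 𝓒 (channelII ε) ≤ ((2 * ε : ℝ) : EReal) := by
  refine sumCapacity_le fun R₁ R₂ hR => ?_
  have hl := Real.log_pos one_lt_two
  have := hR.rate_le (b := 2 * Real.log 2) (by positivity)
    fun τ hτ K₁ K₂ n hK₁ hK₂ hn enc henc g₁ g₂ =>
      success_le_of_isStochastic h0 h1 hτ hK₁ hK₂ hn (h𝓒 _ _ _ _ henc) g₁ g₂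
  exact le_of_mul_le_mul_right this hl

/-! ### Adaptive PR-box protocols -/

/-- Whatever outputs and inputs occur at the other ends of the boxes, an adaptive protocol meets
the PR rule for exactly one string of outputs. The inputs fixed by `σ` override the protocol. -/
lemma BoxProtocol.existsUnique_outputs {k : ℕ} {α : Type} (P : BoxProtocol k α)
    (σ : Fin k → Option Bool) (b y : Fin k → Bool) :
    ∃! a : Fin k → Bool, ∀ i, xor (a i) (b i) = ((σ i).getD (P.input a i) && y i) := by
  induction P generalizing σ with
  | finish x =>
    refine ⟨fun i => xor (b i) ((σ i).getD false && y i), fun i => ?_, fun a ha => ?_⟩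
    · simp [BoxProtocol.input, Bool.xor_comm (b i)]
    · funext i
      rw [show ((σ i).getD false && y i) = xor (a i) (b i) from (ha i).symm]
      cases a i <;> cases b i <;> rfl
  | query j r next ih =>
    -- The first query fixes the input of box j, and the PR rule then forces its output to be `c`.
    -- So only the branch `next c` matters, with that input recorded in `σ` against later queries.
    set r' := (σ j).getD r with hr'
    set c := xor (b j) (r' && y j) with hc
    have hin : ∀ a i, (σ i).getD ((BoxProtocol.query j r next).input a i) =
        (Function.update σ j (some r') i).getD ((next (a j)).input a i) := by
      intro a i
      by_cases hi : i = j
      · subst hi; simp [BoxProtocol.input, hr']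
      · simp [BoxProtocol.input, hi]
    have hiff : ∀ a : Fin k → Bool,
        (∀ i, xor (a i) (b i) = ((σ i).getD ((BoxProtocol.query j r next).input a i) && y i)) ↔
        ∀ i, xor (a i) (b i) =
          ((Function.update σ j (some r') i).getD ((next c).input a i) && y i) := by
      intro a
      have hac : ∀ P' : BoxProtocol k α, (∀ i, xor (a i) (b i) =
          ((Function.update σ j (some r') i).getD (P'.input a i) && y i)) → a j = c := by
        intro P' h
        have := h j
        simp only [Function.update_self, Option.getD_some] at this
        rw [hc, ← this]
        cases a j <;> cases b j <;> rfl
      simp_rw [hin]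
      constructor
      · intro h
        rwa [hac _ h] at h
      · intro h
        rwa [hac _ h]
    simp_rw [hiff]
    exact ih c _

lemma prod_prBox {k : ℕ} (a b x y : Fin k → Bool) :
    ∏ j, prBox (a j) (b j) (x j) (y j) =
      if ∀ j, xor (a j) (b j) = (x j && y j) then (1 / 2 : ℝ) ^ k else 0 := by
  simp only [prBox]
  rw [Finset.prod_ite_zero]
  simp

/-- No-signalling: for each of the 2^k strings b exactly one string a obeys the PR rule, with weight
2^(-k). -/
lemma sum_prod_prBox {k : ℕ} {α β : Type} (P : BoxProtocol k α) (Q : BoxProtocol k β) :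
    ∑ a : Fin k → Bool, ∑ b : Fin k → Bool,
      ∏ j, prBox (a j) (b j) (P.input a j) (Q.input b j) = 1 := by
  rw [Finset.sum_comm]
  have h : ∀ b : Fin k → Bool, ∑ a : Fin k → Bool,
      ∏ j, prBox (a j) (b j) (P.input a j) (Q.input b j) = (1 / 2) ^ k := by
    intro b
    obtain ⟨a, ha, huniq⟩ := P.existsUnique_outputs (fun _ => none) b (Q.input b)
    simp only [Option.getD_none] at ha huniq
    simp_rw [prod_prBox]
    rw [Finset.sum_eq_single a, if_pos ha]
    · intro a' _ hne
      exact if_neg fun h => hne (huniq a' h)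
    · simp
  simp_rw [h]
  simp

lemma prBoxAssisted_sum_mul {K₁ K₂ n k : ℕ} {enc : Encoding K₁ K₂ n}
    {P : Fin K₁ → BoxProtocol k (Fin n → InLetter)} {Q : Fin K₂ → BoxProtocol k (Fin n → InLetter)}
    (h : ∀ m₁ m₂ u v, enc m₁ m₂ u v =
      ∑ a : Fin k → Bool, ∑ b : Fin k → Bool,
        if (P m₁).result a = u ∧ (Q m₂).result b = v then
          ∏ j, prBox (a j) (b j) ((P m₁).input a j) ((Q m₂).input b j)
        else 0) (m₁ : Fin K₁) (m₂ : Fin K₂) (F : (Fin n → InLetter) → (Fin n → InLetter) → ℝ) :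
    ∑ u, ∑ v, enc m₁ m₂ u v * F u v = ∑ a : Fin k → Bool, ∑ b : Fin k → Bool,
      (∏ j, prBox (a j) (b j) ((P m₁).input a j) ((Q m₂).input b j)) *
        F ((P m₁).result a) ((Q m₂).result b) := by
  simp_rw [h, Finset.sum_mul]
  rw [Finset.sum_congr rfl fun u _ => Finset.sum_comm, Finset.sum_comm]
  refine Finset.sum_congr rfl fun a _ => ?_
  rw [Finset.sum_congr rfl fun u _ => Finset.sum_comm, Finset.sum_comm]
  refine Finset.sum_congr rfl fun b _ => ?_
  simp [ite_and]

lemma prBoxAssisted.isStochastic {K₁ K₂ n : ℕ} {enc : Encoding K₁ K₂ n}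
    (h : prBoxAssisted K₁ K₂ n enc) : IsStochastic enc := by
  obtain ⟨k, P, Q, he⟩ := h
  refine ⟨fun m₁ m₂ u v => ?_, fun m₁ m₂ => ?_⟩
  · rw [he]
    refine Finset.sum_nonneg fun a _ => Finset.sum_nonneg fun b _ => ?_
    split_ifs
    · rw [prod_prBox]; split_ifs <;> positivity
    · rfl
  · have := prBoxAssisted_sum_mul he m₁ m₂ (fun _ _ => 1)
    simpa [sum_prod_prBox] using this

/-! ### One PR box per channel use -/

/-- The protocol that puts the bits `x` into the boxes in `l`, and applies `f` to the outputs. -/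
def queryAll {k : ℕ} {α : Type} (x : Fin k → Bool) :
    List (Fin k) → ((Fin k → Bool) → α) → BoxProtocol k α
  | [], f => .finish (f fun _ => false)
  | j :: l, f => .query j (x j) fun b => queryAll x l fun a => f (Function.update a j b)

lemma queryAll_input {k : ℕ} {α : Type} (x : Fin k → Bool) (l : List (Fin k))
    (f : (Fin k → Bool) → α) (a : Fin k → Bool) (i : Fin k) (hi : i ∈ l) :
    (queryAll x l f).input a i = x i := by
  induction l generalizing f with
  | nil => simp at hi
  | cons j l ih =>
    by_cases hij : i = j
    · simp [queryAll, BoxProtocol.input, hij]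
    · simp only [queryAll, BoxProtocol.input, if_neg hij]
      exact ih _ ((List.mem_cons.1 hi).resolve_left hij)

lemma queryAll_result {k : ℕ} {α : Type} (x : Fin k → Bool) (l : List (Fin k))
    (f : (Fin k → Bool) → α) (a : Fin k → Bool) :
    (queryAll x l f).result a = f fun i => if i ∈ l then a i else false := by
  induction l generalizing f with
  | nil => simp [queryAll, BoxProtocol.result]
  | cons j l ih =>
    simp only [queryAll, BoxProtocol.result, ih]
    congr 1
    funext i
    by_cases hij : i = j <;> simp [hij]

/-- Put the bits of `x` into all boxes, and transmit them along with the outputs. -/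
def boxEncoder {n : ℕ} (x : Fin n → Bool) : BoxProtocol n (Fin n → InLetter) :=
  queryAll x (List.finRange n) fun a i => (x i, a i)

lemma boxEncoder_input {n : ℕ} (x a : Fin n → Bool) : (boxEncoder x).input a = x := by
  funext i
  exact queryAll_input _ _ _ _ _ (List.mem_finRange i)

lemma boxEncoder_result {n : ℕ} (x a : Fin n → Bool) :
    (boxEncoder x).result a = fun i => (x i, a i) := by
  simp [boxEncoder, queryAll_result]

/-- The encoding that sends bit codewords with the help of one PR box per channel use. -/
def boxEncoding {K₁ K₂ n : ℕ} (f₁ : Fin K₁ → Fin n → Bool) (f₂ : Fin K₂ → Fin n → Bool) :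
    Encoding K₁ K₂ n := fun m₁ m₂ u v =>
  ∑ a : Fin n → Bool, ∑ b : Fin n → Bool,
    if (boxEncoder (f₁ m₁)).result a = u ∧ (boxEncoder (f₂ m₂)).result b = v then
      ∏ j, prBox (a j) (b j) ((boxEncoder (f₁ m₁)).input a j) ((boxEncoder (f₂ m₂)).input b j)
    else 0

lemma prBoxAssisted_boxEncoding {K₁ K₂ n : ℕ} (f₁ : Fin K₁ → Fin n → Bool)
    (f₂ : Fin K₂ → Fin n → Bool) : prBoxAssisted K₁ K₂ n (boxEncoding f₁ f₂) :=
  ⟨n, fun m => boxEncoder (f₁ m), fun m => boxEncoder (f₂ m), fun _ _ _ _ => rfl⟩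

lemma errorProb_boxEncoding {K₁ K₂ n : ℕ} (ε : ℝ) (f₁ : Fin K₁ → Fin n → Bool)
    (f₂ : Fin K₂ → Fin n → Bool)
    (g₁ : (Fin n → OutLetter) → Option (Fin K₁)) (g₂ : (Fin n → OutLetter) → Option (Fin K₂)) :
    errorProb (channelII ε) (boxEncoding f₁ f₂) g₁ g₂ =
      ((K₁ : ℝ) * (K₂ : ℝ))⁻¹ * ∑ m₁, ∑ m₂, ∑ L : Finset (Fin n),
        ε ^ L.card * (1 - ε) ^ (n - L.card) *
          (if g₁ (survivors (f₁ m₁) L) = some m₁ ∧ g₂ (survivors (f₂ m₂) L) = some m₂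
            then 0 else 1) := by
  rw [errorProb_eq]
  congr 1
  refine Finset.sum_congr rfl fun m₁ _ => Finset.sum_congr rfl fun m₂ _ => ?_
  rw [prBoxAssisted_sum_mul (enc := boxEncoding f₁ f₂) (P := fun m => boxEncoder (f₁ m)) (Q := fun m => boxEncoder (f₂ m))
    (fun _ _ _ _ => rfl)]
  set X := ∑ L : Finset (Fin n), ε ^ L.card * (1 - ε) ^ (n - L.card) *
          (if g₁ (survivors (f₁ m₁) L) = some m₁ ∧ g₂ (survivors (f₂ m₂) L) = some m₂
            then (0 : ℝ) else 1) with hX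
  -- Written as an average over box outputs, X can be compared term by term: where the box
  -- probability is nonzero, the PR rule makes all positions live.
  have hX1 : X = ∑ a : Fin n → Bool, ∑ b : Fin n → Bool, (∏ j, prBox (a j) (b j)
      ((boxEncoder (f₁ m₁)).input a j) ((boxEncoder (f₂ m₂)).input b j)) * X := by
    simp_rw [← Finset.sum_mul]
    rw [sum_prod_prBox, one_mul]
  rw [hX1]
  refine Finset.sum_congr rfl fun a _ => ?_
  refine Finset.sum_congr rfl fun b _ => ?_
  simp only [boxEncoder_input, boxEncoder_result, prod_prBox]
  split_ifs with h
  · congr 1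
    have hlive : livePositions (fun i => (f₁ m₁ i, a i)) (fun i => (f₂ m₂ i, b i)) =
        Finset.univ := by
      exact Finset.filter_true_of_mem fun i _ => h i
    rw [hlive, Finset.powerset_univ, Finset.card_univ, Fintype.card_fin, hX]
    rfl
  · simp

/-! ### Random coding for the binary erasure channel -/

/-- The average error probability of a code for the binary erasure channel in which each position
survives with probability `ε`. -/
def erasureError {K n : ℕ} (ε : ℝ) (f : Fin K → Fin n → Bool)
    (g : (Fin n → OutLetter) → Option (Fin K)) : ℝ :=
  (K : ℝ)⁻¹ * ∑ m, ∑ L : Finset (Fin n), ε ^ L.card * (1 - ε) ^ (n - L.card) *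
    (if g (survivors (f m) L) = some m then 0 else 1)

lemma errorProb_boxEncoding_le {K₁ K₂ n : ℕ} (hK₁ : 0 < K₁) (hK₂ : 0 < K₂) {ε : ℝ} (h0 : 0 ≤ ε)
    (h1 : ε ≤ 1) (f₁ : Fin K₁ → Fin n → Bool) (f₂ : Fin K₂ → Fin n → Bool)
    (g₁ : (Fin n → OutLetter) → Option (Fin K₁)) (g₂ : (Fin n → OutLetter) → Option (Fin K₂)) :
    errorProb (channelII ε) (boxEncoding f₁ f₂) g₁ g₂ ≤
      erasureError ε f₁ g₁ + erasureError ε f₂ g₂ := by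
  have h1' : 0 ≤ 1 - ε := by linarith
  have hk₁ : (K₁ : ℝ) ≠ 0 := by exact_mod_cast hK₁.ne'
  have hk₂ : (K₂ : ℝ) ≠ 0 := by exact_mod_cast hK₂.ne'
  rw [errorProb_boxEncoding]
  calc _ ≤ ((K₁ : ℝ) * (K₂ : ℝ))⁻¹ * ∑ m₁, ∑ m₂,
        ((∑ L : Finset (Fin n), ε ^ L.card * (1 - ε) ^ (n - L.card) *
          (if g₁ (survivors (f₁ m₁) L) = some m₁ then 0 else 1)) +
        ∑ L : Finset (Fin n), ε ^ L.card * (1 - ε) ^ (n - L.card) *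
          (if g₂ (survivors (f₂ m₂) L) = some m₂ then 0 else 1)) := by
        gcongr with m₁ _ m₂ _
        rw [← Finset.sum_add_distrib]
        gcongr with L _
        rw [← mul_add]
        gcongr
        by_cases e1 : g₁ (survivors (f₁ m₁) L) = some m₁ <;>
          by_cases e2 : g₂ (survivors (f₂ m₂) L) = some m₂ <;> simp [e1, e2]
    _ = _ := by
        simp_rw [Finset.sum_add_distrib, Finset.sum_const, Finset.card_univ, Fintype.card_fin,
          nsmul_eq_mul, ← Finset.mul_sum, erasureError]
        field_simp

lemma errorProb_boxEncoding_nonneg {K₁ K₂ n : ℕ} {ε : ℝ} (h0 : 0 ≤ ε) (h1 : ε ≤ 1)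
    (f₁ : Fin K₁ → Fin n → Bool) (f₂ : Fin K₂ → Fin n → Bool)
    (g₁ : (Fin n → OutLetter) → Option (Fin K₁)) (g₂ : (Fin n → OutLetter) → Option (Fin K₂)) :
    0 ≤ errorProb (channelII ε) (boxEncoding f₁ f₂) g₁ g₂ := by
  have h1' : 0 ≤ 1 - ε := by linarith
  rw [errorProb_boxEncoding]
  refine mul_nonneg (by positivity) (Finset.sum_nonneg fun _ _ => Finset.sum_nonneg fun _ _ =>
    Finset.sum_nonneg fun _ _ => mul_nonneg (by positivity) ?_)
  split_ifs <;> norm_num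

open Classical in
/-- Decode to the only message whose codeword is consistent with the received word. -/
def uniqueDecoder {K n : ℕ} (f : Fin K → Fin n → Bool) (y : Fin n → OutLetter) : Option (Fin K) :=
  if h : ∃! m, ∃ L, survivors (f m) L = y then some h.choose else none

lemma agree_of_survivors_eq {n : ℕ} {s t : Fin n → Bool} {L L' : Finset (Fin n)}
    (h : survivors s L' = survivors t L) : ∀ i ∈ L, t i = s i := by
  intro i hi
  have := congrFun h i
  simp only [survivors, hi, if_true] at this
  split_ifs at this
  exact (Option.some.inj this).symm

/-- Union bound: decoding fails only if some other codeword agrees with the sent one on L. -/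
lemma uniqueDecoder_error_le {K n : ℕ} (f : Fin K → Fin n → Bool) (m : Fin K)
    (L : Finset (Fin n)) :
    (if uniqueDecoder f (survivors (f m) L) = some m then (0 : ℝ) else 1) ≤
      ∑ m' ∈ Finset.univ.erase m, if ∀ i ∈ L, f m i = f m' i then 1 else 0 := by
  have hnn : ∀ m' ∈ Finset.univ.erase m,
      (0 : ℝ) ≤ if ∀ i ∈ L, f m i = f m' i then 1 else 0 := by
    intro m' _; split_ifs <;> norm_num
  split_ifs with h
  · exact Finset.sum_nonneg hnn
  · by_contra! hlt
    apply h
    have huniq : ∀ m', (∃ L', survivors (f m') L' = survivors (f m) L) → m' = m := by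
      rintro m' ⟨L', hL'⟩
      by_contra hne
      have h2 := Finset.single_le_sum hnn (Finset.mem_erase.2 ⟨hne, Finset.mem_univ m'⟩)
      rw [if_pos (agree_of_survivors_eq hL')] at h2
      linarith
    have hex : ∃! m', ∃ L', survivors (f m') L' = survivors (f m) L := ⟨m, ⟨L, rfl⟩, huniq⟩
    rw [uniqueDecoder, dif_pos hex, huniq _ hex.choose_spec.1]

/-- Two codewords of a uniformly random code agree on `L` with probability `2 ^ (-|L|)`. -/
lemma sum_code_agree {K n : ℕ} {m m' : Fin K} (hne : m ≠ m') (L : Finset (Fin n)) :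
    ∑ f : Fin K → Fin n → Bool, (if ∀ i ∈ L, f m i = f m' i then (1 : ℝ) else 0) =
      Fintype.card (Fin K → Fin n → Bool) * ((2 : ℝ) ^ L.card)⁻¹ := by
  -- Exchanging codeword m' with a fresh word w preserves the count of pairs (f, w) and makes word
  -- m' free, so `sum_agree` applies.
  have hinv : Function.Involutive
      (fun p : (Fin K → Fin n → Bool) × (Fin n → Bool) => (Function.update p.1 m' p.2, p.1 m')) := by
    rintro ⟨f, w⟩; simp
  set F : (Fin K → Fin n → Bool) → ℝ := fun f => if ∀ i ∈ L, f m i = f m' i then 1 else 0 with hF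
  have h := Equiv.sum_comp hinv.toPerm (fun p => F p.1)
  simp only [Function.Involutive.coe_toPerm, Fintype.sum_prod_type] at h
  have hw : ∀ f : Fin K → Fin n → Bool, ∑ w, F (Function.update f m' w) = 2 ^ (n - L.card) := by
    intro f
    rw [← sum_agree (f m) L]
    simp only [hF, Function.update_self, Function.update_of_ne hne]
  simp only [hw, Finset.sum_const, Finset.card_univ, nsmul_eq_mul] at h
  rw [← Finset.mul_sum] at h
  have hL : L.card ≤ n := by simpa using Finset.card_le_univ L
  have h2 : (2 : ℝ) ^ (n - L.card) = 2 ^ n * ((2 : ℝ) ^ L.card)⁻¹ := pow_sub₀ _ (by norm_num) hL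
  rw [h2] at h
  have h3 : (Fintype.card (Fin n → Bool) : ℝ) = 2 ^ n := by simp
  rw [h3] at h
  have h4 : (2 : ℝ) ^ n ≠ 0 := by positivity
  apply mul_left_cancel₀ h4
  rw [← h]; ring

/-- Random coding for the binary erasure channel. -/
lemma exists_erasure_code {K n : ℕ} (hK : 0 < K) {ε c : ℝ} (h0 : 0 ≤ ε) (h1 : ε ≤ 1)
    (hc : 0 < c) :
    ∃ f : Fin K → Fin n → Bool, erasureError ε f (uniqueDecoder f) ≤
      n / c ^ 2 + K * Real.exp (-((ε * n - c) * Real.log 2)) := by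
  have h1' : 0 ≤ 1 - ε := by linarith
  have hk : (0 : ℝ) < K := by exact_mod_cast hK
  set B := Real.exp (-((ε * n - c) * Real.log 2)) with hB
  set w : Finset (Fin n) → ℝ := fun L => ε ^ L.card * (1 - ε) ^ (n - L.card) with hw
  have hw0 : ∀ L, 0 ≤ w L := fun L => by positivity
  have hw1 : ∑ L, w L = 1 := by
    have := sum_powerset_weight (Finset.univ : Finset (Fin n)) ε
    rwa [Finset.powerset_univ, Finset.card_univ, Fintype.card_fin] at this
  have htail : ∑ L, (if c ≤ |(L.card : ℝ) - ε * n| then w L else 0) ≤ n / c ^ 2 := by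
    have := sum_powerset_tail_le (Finset.univ : Finset (Fin n)) h0 h1 hc
    rwa [Finset.powerset_univ, Finset.card_univ, Fintype.card_fin, Finset.sum_filter] at this
  -- The bound is proved for the sum over all codes; some code is then no worse than average.
  have hsum : ∑ f : Fin K → Fin n → Bool, erasureError ε f (uniqueDecoder f) ≤
      ∑ f : Fin K → Fin n → Bool, (n / c ^ 2 + K * B) := by
    set M : ℝ := (Fintype.card (Fin K → Fin n → Bool) : ℝ) with hM
    have hM0 : 0 ≤ M := by positivity
    have hpt : ∀ (m : Fin K) (L : Finset (Fin n)), ∑ f : Fin K → Fin n → Bool,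
        w L * (if uniqueDecoder f (survivors (f m) L) = some m then 0 else 1) ≤
        M * ((if c ≤ |(L.card : ℝ) - ε * n| then w L else 0) + w L * (K * B)) := by
      intro m L
      by_cases ht : c ≤ |(L.card : ℝ) - ε * n|
      · rw [if_pos ht]
        calc _ ≤ ∑ f : Fin K → Fin n → Bool, w L := by
              refine Finset.sum_le_sum fun f _ => mul_le_of_le_one_right (hw0 L) ?_
              split_ifs <;> norm_num
          _ = M * w L := by simp [hM]
          _ ≤ _ := by
              have := hw0 L
              gcongr
              have : 0 ≤ w L * (K * B) := by positivity
              linarith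
      · rw [if_neg ht, zero_add]
        have hcard : ε * n - c ≤ L.card := by linarith [(abs_lt.1 (not_le.1 ht)).1]
        have hpow : ((2 : ℝ) ^ L.card)⁻¹ ≤ B := by
          rw [hB, ← Real.exp_log two_pos, ← Real.exp_nat_mul, ← Real.exp_neg, Real.exp_le_exp,
            Real.exp_log two_pos]
          have := Real.log_pos one_lt_two
          nlinarith
        calc _ ≤ ∑ f : Fin K → Fin n → Bool, w L *
              ∑ m' ∈ Finset.univ.erase m, (if ∀ i ∈ L, f m i = f m' i then 1 else 0) := by
              gcongr with f _
              exact uniqueDecoder_error_le f m L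
          _ = w L * ∑ m' ∈ Finset.univ.erase m, M * ((2 : ℝ) ^ L.card)⁻¹ := by
              rw [← Finset.mul_sum, Finset.sum_comm]
              congr 1
              refine Finset.sum_congr rfl fun m' hm' => ?_
              exact sum_code_agree (Finset.ne_of_mem_erase hm').symm L
          _ ≤ w L * ∑ m' : Fin K, M * B := by
              have := hw0 L
              gcongr
              refine (Finset.sum_le_sum fun m' _ => mul_le_mul_of_nonneg_left hpow hM0).trans ?_
              exact Finset.sum_le_sum_of_subset_of_nonneg (Finset.subset_univ _)
                fun _ _ _ => by positivity
          _ = _ := by simp; ring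
    have hswap : ∑ f : Fin K → Fin n → Bool, erasureError ε f (uniqueDecoder f) =
        (K : ℝ)⁻¹ * ∑ m, ∑ L, ∑ f : Fin K → Fin n → Bool,
          w L * (if uniqueDecoder f (survivors (f m) L) = some m then 0 else 1) := by
      simp only [erasureError]
      rw [← Finset.mul_sum, Finset.sum_comm]
      congr 1
      exact Finset.sum_congr rfl fun m _ => Finset.sum_comm
    rw [hswap]
    calc _ ≤ (K : ℝ)⁻¹ * ∑ m : Fin K, ∑ L,
          M * ((if c ≤ |(L.card : ℝ) - ε * n| then w L else 0) + w L * (K * B)) := by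
          gcongr with m _ L _
          exact hpt m L
      _ = M * ((∑ L, if c ≤ |(L.card : ℝ) - ε * n| then w L else 0) + K * B) := by
          rw [Finset.sum_const, Finset.card_univ, Fintype.card_fin, nsmul_eq_mul,
            inv_mul_cancel_left₀ hk.ne', ← Finset.mul_sum, Finset.sum_add_distrib,
            ← Finset.sum_mul, hw1, one_mul]
      _ ≤ M * (n / c ^ 2 + K * B) := by gcongr
      _ = _ := by rw [Finset.sum_const, Finset.card_univ, nsmul_eq_mul]
  obtain ⟨f, -, hf⟩ := Finset.exists_le_of_sum_le Finset.univ_nonempty hsum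
  exact ⟨f, hf⟩

lemma messageCount_le {n : ℕ} {R : ℝ} (hR : 0 ≤ R) :
    (messageCount n R : ℝ) ≤ 2 * Real.exp (n * (R * Real.log 2)) := by
  have h2 : (2 : ℝ) = Real.exp (Real.log 2) := (Real.exp_log two_pos).symm
  rw [messageCount, Nat.cast_pow, Nat.cast_ofNat, ← Real.rpow_natCast, Real.rpow_def_of_pos two_pos]
  nth_rewrite 2 [h2]
  rw [← Real.exp_add, Real.exp_le_exp]
  have := (Nat.ceil_lt_add_one (by positivity : 0 ≤ (n : ℝ) * R)).le
  nlinarith [Real.log_pos one_lt_two]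

/-- Rates below `ε` are achievable on the binary erasure channel. -/
lemma exists_erasure_codes {ε R : ℝ} (hR : 0 ≤ R) (hRε : R < ε) (h1 : ε ≤ 1) :
    ∃ f : ∀ n : ℕ, Fin (messageCount n R) → Fin n → Bool, Filter.Tendsto
      (fun n => erasureError ε (f n) (uniqueDecoder (f n))) Filter.atTop (nhds 0) := by
  -- Half the gap goes to the fluctuation of the survivor count; the other half is the error
  -- exponent.
  set τ := (ε - R) / 2 with hτ
  have hτ0 : 0 < τ := by rw [hτ]; linarith
  have hl := Real.log_pos one_lt_two
  have h : ∀ n : ℕ, ∃ f : Fin (messageCount n R) → Fin n → Bool, 0 < n →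
      erasureError ε f (uniqueDecoder f) ≤
        (τ ^ 2)⁻¹ * (n : ℝ)⁻¹ + 2 * Real.exp (-((τ * Real.log 2) * n)) := by
    intro n
    rcases Nat.eq_zero_or_pos n with hn | hn
    · exact ⟨fun _ _ => false, fun h => absurd hn h.ne'⟩
    · have hn' : (0 : ℝ) < n := by exact_mod_cast hn
      obtain ⟨f, hf⟩ := exists_erasure_code (n := n) (messageCount_pos n R) (hR.trans hRε.le) h1
        (mul_pos hτ0 hn')
      refine ⟨f, fun _ => hf.trans (add_le_add (le_of_eq ?_) ?_)⟩
      · field_simp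
      · refine (mul_le_mul_of_nonneg_right (messageCount_le hR) (Real.exp_pos _).le).trans
          (le_of_eq ?_)
        rw [mul_assoc, ← Real.exp_add]
        congr 2
        rw [hτ]; ring
  choose f hf using h
  refine ⟨f, ?_⟩
  have hlim : Filter.Tendsto (fun n : ℕ => (τ ^ 2)⁻¹ * (n : ℝ)⁻¹ +
      2 * Real.exp (-((τ * Real.log 2) * n))) Filter.atTop (nhds ((τ ^ 2)⁻¹ * 0 + 2 * 0)) := by
    refine (tendsto_inv_atTop_nhds_zero_nat.const_mul _).add (Filter.Tendsto.const_mul _ ?_)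
    exact Real.tendsto_exp_neg_atTop_nhds_zero.comp
      (tendsto_natCast_atTop_atTop.const_mul_atTop (mul_pos hτ0 hl))
  rw [mul_zero, mul_zero, add_zero] at hlim
  refine tendsto_of_tendsto_of_tendsto_of_le_of_le' tendsto_const_nhds hlim
    (Filter.Eventually.of_forall fun n => ?_) ?_
  · have h1' : 0 ≤ 1 - ε := by linarith
    have h0 : 0 ≤ ε := hR.trans hRε.le
    refine mul_nonneg (by positivity) (Finset.sum_nonneg fun _ _ => Finset.sum_nonneg fun _ _ =>
      mul_nonneg (by positivity) ?_)
    split_ifs <;> norm_num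
  · filter_upwards [Filter.eventually_gt_atTop 0] with n hn using hf n hn

lemma achievable_prBoxAssisted {ε R₁ R₂ : ℝ} (h1 : ε ≤ 1) (hR₁ : 0 ≤ R₁) (hR₁ε : R₁ < ε)
    (hR₂ : 0 ≤ R₂) (hR₂ε : R₂ < ε) : Achievable prBoxAssisted (channelII ε) R₁ R₂ := by
  obtain ⟨f₁, hf₁⟩ := exists_erasure_codes hR₁ hR₁ε h1
  obtain ⟨f₂, hf₂⟩ := exists_erasure_codes hR₂ hR₂ε h1
  have h0 : 0 ≤ ε := hR₁.trans hR₁ε.le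
  refine ⟨hR₁, hR₂, fun n => boxEncoding (f₁ n) (f₂ n), fun n => uniqueDecoder (f₁ n),
    fun n => uniqueDecoder (f₂ n), fun n => prBoxAssisted_boxEncoding _ _, ?_⟩
  have hlim := hf₁.add hf₂
  rw [add_zero] at hlim
  exact squeeze_zero (fun n => errorProb_boxEncoding_nonneg h0 h1 _ _ _ _)
    (fun n => errorProb_boxEncoding_le (messageCount_pos _ _) (messageCount_pos _ _) h0 h1 _ _ _ _)
    hlim

/-! ### The super-quantum lower bound and the conclusion -/

lemma two_mul_le_sumCapacity_prBoxAssisted {ε : ℝ} (h0 : 0 < ε) (h1 : ε ≤ 1) :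
    ((2 * ε : ℝ) : EReal) ≤ sumCapacity prBoxAssisted (channelII ε) := by
  refine le_of_forall_lt fun x hx => ?_
  obtain ⟨r, hxr, hr⟩ := EReal.lt_iff_exists_real_btwn.1 hx
  have hr' : r < 2 * ε := by exact_mod_cast hr
  -- Rates must be nonnegative, but r may be negative.
  have hR : max (r / 2) 0 < ε := max_lt (by linarith) h0
  refine hxr.trans_le (le_trans ?_ (le_sSup ⟨_, _, achievable_prBoxAssisted h1
    (le_max_right _ _) hR (le_max_right _ _) hR, rfl⟩))
  have := le_max_left (r / 2) 0
  exact_mod_cast (by linarith : r ≤ max (r / 2) 0 + max (r / 2) 0)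

end

theorem mainTheorem5 :
    ∃ ε₀ : ℝ, 0 < ε₀ ∧ ε₀ ≤ 1 ∧ ∀ ε : ℝ, 0 < ε → ε < ε₀ →
      sumCapacity entanglementAssisted (channelII ε) < sumCapacity prBoxAssisted (channelII ε) ∧
      sumCapacity prBoxAssisted (channelII ε) = ((2 * ε : ℝ) : EReal) := by
  -- Both converse estimates hold up to 1/20, and they leave the gap between 1.98 ε and 2ε.
  refine ⟨1 / 20, by norm_num, by norm_num, fun ε h0 h1 => ?_⟩
  have h : sumCapacity prBoxAssisted (channelII ε) = ((2 * ε : ℝ) : EReal) :=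
    le_antisymm (sumCapacity_le_two_mul (fun _ _ _ _ => prBoxAssisted.isStochastic) h0.le h1.le)
      (two_mul_le_sumCapacity_prBoxAssisted h0 (by linarith))
  refine ⟨?_, h⟩
  rw [h]
  refine (sumCapacity_entanglementAssisted_le h0.le h1.le).trans_lt ?_
  exact_mod_cast (by linarith : 198 / 100 * ε < 2 * ε)
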